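/- Let ${\mathcal G}=(B\cup W,E)$ be a finite simple planar bipartite graph with black vertices $B$ and white vertices $W$, with a given planar embedding, and let $\nu:E\to\mathbb{R}_{>0}$ be a weight function on its edges. A dimer cover is a set of edges $M\subset E$ such that each vertex is the endpoint of exactly one edge of $M$; suppose that at least one dimer cover exists. The Boltzmann measure is the probability measure $\mu(M)=\frac1Z\prod_{e\in M}\nu(e)$ on dimer covers, where $Z=\sum_M\prod_{e\in M}\nu(e)$. A Kasteleyn weighting is a function $\varepsilon:E\to\{z\in\mathbb{C}:|z|=1\}$ such that, for each face, with edges $e_1,\dots,e_{2m}$ in cyclic order along its boundary walk, the alternating product $\frac{\varepsilon(e_1)\varepsilon(e_3)\cdots\varepsilon(e_{2m-1})}{\varepsilon(e_2)\varepsilon(e_4)\cdots\varepsilon(e_{2m})}$ is negative real if $2m\equiv 0\bmod 4$ and positive real if $2m\equiv 2\bmod 4$. (An edge with the same face on both sides is counted twice; if ${\mathcal G}$ is disconnected, the condition is imposed on the faces of each connected component embedded by itself. For $\varepsilon=\pm1$ the condition says that each face with $0\bmod 4$ edges has an odd number of $-$ signs and each face with $2\bmod 4$ edges has an even number of $-$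 signs.) The associated Kasteleyn matrix is the $|B|\times|W|$ matrix $K$ with $K(b,w)=\varepsilon(bw)\,\nu(bw)$ if $bw\in E$ and $K(b,w)=0$ otherwise. Then, for each Kasteleyn weighting, $K$ is invertible, and for every $k\ge 0$ and all distinct edges $w_1b_1,\dots,w_kb_k$ (with $w_i\in W$, $b_i\in B$), the $\mu$-probability that all of these edges lie in the random dimer cover is $$\left(\prod_{i=1}^k K(b_i,w_i)\right)\det\bigl(K^{-1}(w_i,b_j)\bigr)_{1\le i,j\le k}.$$ In other words, the edges of the random dimer cover form a determinantal process: the probability that it contains given distinct edges $p_1,\dots,p_k$ is $\det\bigl(T(p_i,p_j)\bigr)_{1\le i,j\le k}$, where $T(p,p')=K(b,w)\,K^{-1}(w,b')$, $b$ and $w$ are the black and white vertices of $p$, and $b'$ is the black vertex of $p'$. -/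

import Mathlib

namespace DimerModel

/-! ### Combinatorial embeddings of graphs and planarity -/

section Embedding

variable {V : Type*} {G : SimpleGraph V}

/-- A rotation system on a graph (a combinatorial map, i.e. an embedding of each connected
component of the graph in an oriented closed surface, cut into discs): a permutation `rot` of the
darts (oriented edges) that permutes cyclically the darts issuing from each vertex. `rot d` is the
next dart after `d` in counterclockwise order around the initial vertex of `d`. -/
structure RotationSystem (G : SimpleGraph V) where
  rot : Equiv.Perm G.Dart
  fst_rot : ∀ d, (rot d).fst = d.fst
  sameCycle_rot : ∀ d d' : G.Dart, d.fst = d'.fst → rot.SameCycle d d'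

/-- Reversal of darts, as a permutation. -/
def dartRev (G : SimpleGraph V) : Equiv.Perm G.Dart where
  toFun := SimpleGraph.Dart.symm
  invFun := SimpleGraph.Dart.symm
  left_inv d := d.symm_symm
  right_inv d := d.symm_symm

namespace RotationSystem

variable (R : RotationSystem G)

/-- The face permutation: the dart `u → v` is followed, along the boundary of the face on one fixed
side of it, by the dart that comes after `v → u` in the rotation at `v`. -/
def faceStep : Equiv.Perm G.Dart := R.rot * dartRev G

/-- The faces: the cycles of the face permutation (closed walks around the faces). -/
def Face : Type _ := Quotient (Equiv.Perm.SameCycle.setoid R.faceStep)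

/-- The face whose boundary walk contains the dart `d`. -/
def faceOf (d : G.Dart) : R.Face := Quotient.mk _ d

/-- The rotation system is planar: every connected component `c` with at least one edge satisfies
Euler's formula `|V(c)| - |E(c)| + |F(c)| = 2`. (A component without edges is an isolated vertex.)
-/
def IsPlanar : Prop :=
  ∀ c : G.ConnectedComponent, (∃ d : G.Dart, d.fst ∈ c.supp) →
    (c.supp.ncard : ℤ)
      - ({e : Sym2 V | e ∈ G.edgeSet ∧ ∃ v ∈ e, v ∈ c.supp}.ncard : ℤ)
      + ({f : R.Face | ∃ d : G.Dart, R.faceOf d = f ∧ d.fst ∈ c.supp}.ncard : ℤ) = 2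

open Classical in
/-- The darts of the boundary walk of the face that contains `d₀`. An edge that has this face on
both of its sides contributes both of its darts, so it is counted twice. -/
noncomputable def faceDarts [Fintype V] (d₀ : G.Dart) : Finset G.Dart :=
  Finset.univ.filter fun d => R.faceOf d = R.faceOf d₀

end RotationSystem

end Embedding

/-! ### Bipartite graphs, dimer covers, the Boltzmann measure -/

section Dimers

variable {B W : Type*}

/-- The edges of a bipartite graph on the black vertices `B` and the white vertices `W`, as pairs
(black end, white end). -/
abbrev Edge (G : SimpleGraph (B ⊕ W)) : Type _ :=
  {p : B × W // G.Adj (Sum.inl p.1) (Sum.inr p.2)}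

variable {G : SimpleGraph (B ⊕ W)}

/-- The black end of an edge. -/
def Edge.black (e : Edge G) : B := e.1.1

/-- The white end of an edge. -/
def Edge.white (e : Edge G) : W := e.1.2

/-- Dimer covers: sets of edges such that every vertex, black or white, is the end of exactly one
edge of the set. -/
def DimerCover (G : SimpleGraph (B ⊕ W)) : Type _ :=
  {M : Finset (Edge G) // (∀ b : B, ∃! e, e ∈ M ∧ Edge.black e = b) ∧
    (∀ w : W, ∃! e, e ∈ M ∧ Edge.white e = w)}

/-- The set of edges of a dimer cover. -/
def DimerCover.edges (M : DimerCover G) : Finset (Edge G) := M.1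

instance [Finite B] [Finite W] : Finite (DimerCover G) :=
  inferInstanceAs (Finite (Subtype _))

noncomputable instance [Finite B] [Finite W] : Fintype (DimerCover G) := Fintype.ofFinite _

variable [Fintype B] [Fintype W]

/-- The partition function `Z = ∑_M ∏_{e ∈ M} ν e`. -/
noncomputable def partitionFunction (ν : Edge G → ℝ) : ℝ :=
  ∑ M : DimerCover G, ∏ e ∈ M.edges, ν e

/-- The Boltzmann probability of a single dimer cover, `μ(M) = Z⁻¹ ∏_{e ∈ M} ν e`. -/
noncomputable def boltzmann (ν : Edge G → ℝ) (M : DimerCover G) : ℝ :=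
  (partitionFunction ν)⁻¹ * ∏ e ∈ M.edges, ν e

open Classical in
/-- The probability of an event `A`, for the law with point masses `μ` on a finite set. -/
noncomputable def prob {Ω : Type*} [Fintype Ω] (μ : Ω → ℝ) (A : Set Ω) : ℝ :=
  ∑ ω ∈ Finset.univ.filter (fun ω => ω ∈ A), μ ω

/-- The random subset `X` of `E` is a determinantal point process with kernel `T`: the probability
that it contains given distinct points `p₁, …, pₖ` is `det (T (pᵢ, pⱼ))`. -/
def IsDeterminantalProcess {Ω E : Type*} [Fintype Ω] (μ : Ω → ℝ) (X : Ω → Finset E)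
    (T : E → E → ℂ) : Prop :=
  ∀ (k : ℕ) (p : Fin k → E), Function.Injective p →
    ((prob μ {ω | ∀ i, p i ∈ X ω} : ℝ) : ℂ) = (Matrix.of fun i j => T (p i) (p j)).det

/-! ### Kasteleyn weightings and Kasteleyn matrices -/

/-- The value of `ε` on the edge of a dart that goes from black to white, and its inverse for a dart
that goes from white to black. (In a bipartite graph there are no other darts.) -/
noncomputable def dartFactor (ε : Edge G → ℂ) : G.Dart → ℂ
  | ⟨(Sum.inl b, Sum.inr w), h⟩ => ε ⟨(b, w), h⟩
  | ⟨(Sum.inr w, Sum.inl b), h⟩ => (ε ⟨(b, w), h.symm⟩)⁻¹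
  | _ => 1

/-- The alternating product `ε(e₁) ε(e₃) ⋯ / (ε(e₂) ε(e₄) ⋯)` along the boundary walk
`e₁, e₂, …, e₂ₖ` of the face that contains `d₀`. As the colours of the vertices alternate along the
walk, the edges run from black to white go to the numerator, the others to the denominator. -/
noncomputable def alternatingProduct (R : RotationSystem G) (ε : Edge G → ℂ) (d₀ : G.Dart) : ℂ :=
  ∏ d ∈ R.faceDarts d₀, dartFactor ε d

/-- A Kasteleyn weighting: a complex number of modulus `1` for each edge, such that the alternating
product around each face is negative real if the face has `0 mod 4` edges and positive real if it
has `2 mod 4` edges. -/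
structure IsKasteleynWeighting (R : RotationSystem G) (ε : Edge G → ℂ) : Prop where
  norm_eq_one : ∀ e, ‖ε e‖ = 1
  neg_of_mod_four_eq_zero : ∀ d₀ : G.Dart, (R.faceDarts d₀).card % 4 = 0 →
    ∃ r : ℝ, r < 0 ∧ alternatingProduct R ε d₀ = r
  pos_of_mod_four_eq_two : ∀ d₀ : G.Dart, (R.faceDarts d₀).card % 4 = 2 →
    ∃ r : ℝ, 0 < r ∧ alternatingProduct R ε d₀ = r

open Classical in
/-- In particular a choice of signs `±1` is a Kasteleyn weighting if each face with `0 mod 4` edges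
has an odd number of minus signs and each face with `2 mod 4` edges has an even number of them. -/
theorem isKasteleynWeighting_of_signs (R : RotationSystem G) (ε : Edge G → ℂ)
    (hε : ∀ e, ε e = 1 ∨ ε e = -1)
    (h0 : ∀ d₀ : G.Dart, (R.faceDarts d₀).card % 4 = 0 →
      Odd ((R.faceDarts d₀).filter fun d => dartFactor ε d = -1).card)
    (h2 : ∀ d₀ : G.Dart, (R.faceDarts d₀).card % 4 = 2 →
      Even ((R.faceDarts d₀).filter fun d => dartFactor ε d = -1).card) :
    IsKasteleynWeighting R ε := by
  have hd : ∀ d : G.Dart, dartFactor ε d = if dartFactor ε d = -1 then -1 else 1 := by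
    intro d
    have h1 : dartFactor ε d = 1 ∨ dartFactor ε d = -1 := by
      rcases d with ⟨⟨u | u, v | v⟩, h⟩
      · exact Or.inl rfl
      · exact hε _
      · rcases hε ⟨(v, u), h.symm⟩ with h' | h' <;> simp [dartFactor, h']
      · exact Or.inl rfl
    rcases h1 with h1 | h1 <;> rw [h1] <;> norm_num
  have hp : ∀ d₀ : G.Dart, alternatingProduct R ε d₀ =
      (-1) ^ ((R.faceDarts d₀).filter fun d => dartFactor ε d = -1).card := by
    intro d₀
    rw [alternatingProduct, Finset.prod_congr rfl fun d _ => hd d, Finset.prod_ite]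
    simp
  refine ⟨fun e => ?_, fun d₀ h => ⟨-1, by norm_num, ?_⟩, fun d₀ h => ⟨1, by norm_num, ?_⟩⟩
  · rcases hε e with h | h <;> simp [h]
  · rw [hp, (h0 d₀ h).neg_one_pow]; simp
  · rw [hp, (h2 d₀ h).neg_one_pow]; simp

open Classical in
/-- The Kasteleyn matrix: `K(b, w) = 0` if there is no edge between `b` and `w`, and otherwise it is
the Kasteleyn weighting times the weight of the edge. -/
noncomputable def kasteleynMatrix (ν : Edge G → ℝ) (ε : Edge G → ℂ) : Matrix B W ℂ :=
  Matrix.of fun b w =>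
    if h : G.Adj (Sum.inl b) (Sum.inr w) then ε ⟨(b, w), h⟩ * (ν ⟨(b, w), h⟩ : ℂ) else 0

end Dimers

end DimerModel

namespace DimerModel

/-! Expanded over bijections from black to white vertices, the determinant of `K` is a signed sum
over dimer covers. The main point is that a Kasteleyn weighting gives all terms the same phase
(`IsKasteleynWeighting.sign_mul_prod`).

For two covers σ₀ and σ₁, the difference of their indicators, with edges directed from black to
white, is a flow without sources. By planarity it is the boundary of an integer function `f` on the
faces; Euler's formula enters here, in a comparison of ranks. The quotient of the ε-products of the
two covers is then the product over the faces of the alternating products raised to the powers `f`.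
The Kasteleyn condition turns it into a sign that depends only on the region where `f` is odd: the
parity of its number of faces plus its number of darts starting at black vertices.

This sign has to be that of π = σ₀⁻¹σ₁. Instead of separating the loops of σ₀ ∪ σ₁, the proof
compares signs of permutations of the darts of the region. The face permutation is the product of a
permutation whose cycles correspond to the vertices of the region, an even number, and of
`alternate`, which follows the two covers by turns; so the sign of `alternate` is the parity of the
faces (`IsRegion.neg_one_pow_card_faces`). On the other hand `alternate` exchanges black and white
starting points, and its square moves boundary darts along π or its inverse
(`IsRegion.sign_alternate`).

The resulting determinant formula holds for all complex edge weights. Multiplying the weights of the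
chosen edges by 1 + s gives a generating function on the side of the covers, and det K · det(1 + sT)
on the other side. The top coefficients in s give the probability that all chosen edges occur. -/

/-! ### Signs of permutations -/

-- A cycle of length l has sign (-1)^(l-1), so the sign is the parity of the number of points minus
-- the number of cycles. The map `q` labels the cycles, fixed points included; a fixed point adds
-- one to both cardinals and does not matter.
open Equiv.Perm in
theorem sign_eq_neg_one_pow_of_sameCycle_iff {α β : Type*} [Fintype α] [DecidableEq α] [Fintype β]
    (σ : Equiv.Perm α) (q : α → β) (hq : Function.Surjective q)
    (h : ∀ x y, σ.SameCycle x y ↔ q x = q y) :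
    Equiv.Perm.sign σ = (-1) ^ (Fintype.card α + Fintype.card β) := by
  classical
  have himg : σ.cycleFactorsFinset = σ.support.image σ.cycleOf := by
    ext c
    simp only [Finset.mem_image]
    constructor
    · intro hc
      have hc' := (mem_cycleFactorsFinset_iff.1 hc)
      obtain ⟨x, hx, -⟩ := hc'.1
      have hx' : x ∈ c.support := mem_support.2 hx
      exact ⟨x, mem_cycleFactorsFinset_support_le hc hx',
        ((eq_cycleOf_of_mem_cycleFactorsFinset_iff σ c hc x).2 hx').symm⟩
    · rintro ⟨x, hx, rfl⟩
      exact cycleOf_mem_cycleFactorsFinset_iff.2 hx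
  have hker : ∀ x ∈ σ.support, ∀ y ∈ σ.support, σ.cycleOf x = σ.cycleOf y ↔ q x = q y := by
    intro x hx y hy
    rw [← h]
    constructor
    · intro e
      have : σ.cycleOf x y ≠ y := by
        rw [e, cycleOf_apply_self]; exact mem_support.1 hy
      by_contra hn
      exact this (cycleOf_apply_of_not_sameCycle hn)
    · exact fun e => e.cycleOf_eq
  have hcard : σ.cycleFactorsFinset.card = (σ.support.image q).card := by
    rw [himg]
    have h1 : σ.support.image q = (σ.support.image fun x => (q x, σ.cycleOf x)).image Prod.fst := by
      rw [Finset.image_image]; rfl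
    have h2 : σ.support.image σ.cycleOf =
        (σ.support.image fun x => (q x, σ.cycleOf x)).image Prod.snd := by
      rw [Finset.image_image]; rfl
    rw [h1, h2, Finset.card_image_of_injOn (f := Prod.fst), Finset.card_image_of_injOn]
    · intro a ha b hb hab
      obtain ⟨x, hx, rfl⟩ := Finset.mem_image.1 (Finset.mem_coe.1 ha)
      obtain ⟨y, hy, rfl⟩ := Finset.mem_image.1 (Finset.mem_coe.1 hb)
      exact Prod.ext ((hker x hx y hy).1 hab) hab
    · intro a ha b hb hab
      obtain ⟨x, hx, rfl⟩ := Finset.mem_image.1 (Finset.mem_coe.1 ha)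
      obtain ⟨y, hy, rfl⟩ := Finset.mem_image.1 (Finset.mem_coe.1 hb)
      exact Prod.ext hab ((hker x hx y hy).2 hab)
  have hfix : (σ.supportᶜ.image q).card = σ.supportᶜ.card := by
    apply Finset.card_image_of_injOn
    intro x hx y _ hxy
    have hx' : σ x = x := by simpa using hx
    exact ((h x y).2 hxy).eq_of_left hx'
  have hβ : Fintype.card β = σ.cycleFactorsFinset.card + σ.supportᶜ.card := by
    rw [hcard, ← hfix, ← Finset.card_union_of_disjoint, ← Finset.image_union,
      Finset.union_compl, Finset.image_univ_of_surjective hq, Finset.card_univ]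
    rw [Finset.disjoint_left]
    intro b hb hb'
    obtain ⟨x, hx, rfl⟩ := Finset.mem_image.1 hb
    obtain ⟨y, hy, hxy⟩ := Finset.mem_image.1 hb'
    have hy' : σ y = y := by simpa using hy
    have := ((h y x).2 hxy).eq_of_left hy'
    subst this
    simp at hy
    exact mem_support.1 hx hy
  rw [sign_of_cycleType, sum_cycleType, hβ, ← Finset.card_add_card_compl σ.support]
  have : σ.cycleType.card = σ.cycleFactorsFinset.card := by simp [cycleType]
  rw [this, show σ.support.card + σ.supportᶜ.card + (σ.cycleFactorsFinset.card + σ.supportᶜ.card)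
    = (σ.support.card + σ.cycleFactorsFinset.card) + 2 * σ.supportᶜ.card by ring, pow_add _ _ (2 * _),
    pow_mul]
  simp

theorem sq_preserves {α : Type*} {p : α → Prop} {τ : Equiv.Perm α} (h : ∀ x, p (τ x) ↔ ¬ p x)
    (x : α) : p ((τ * τ) x) ↔ p x := by
  simp [h]

/-- A permutation that exchanges a set with its complement has the sign of its square on this set,
up to the parity of the set. -/
theorem sign_of_swaps {α : Type*} [Fintype α] [DecidableEq α] (p : α → Prop)
    [Fintype {x // p x}] (τ : Equiv.Perm α) (h : ∀ x, p (τ x) ↔ ¬ p x) :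
    Equiv.Perm.sign τ = (-1) ^ Fintype.card {x // p x} *
      Equiv.Perm.sign ((τ * τ).subtypePerm (sq_preserves h)) := by
  classical
  have h' : ∀ x, p (τ.symm x) ↔ ¬ p x := fun x => by
    have := h (τ.symm x); rw [Equiv.apply_symm_apply] at this; tauto
  -- The involution `f` exchanges each point of the set with one outside it, so it is a product of
  -- as many transpositions as the set has points. The product of `f` and `τ` is `τ * τ` on the set
  -- and the identity off it.
  let f : α → α := fun x => if p x then τ.symm x else τ x
  have hf : Function.Involutive f := by
    intro x
    by_cases hx : p x <;> simp [f, hx, h, h']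
  have hsf : Equiv.Perm.sign hf.toPerm = (-1) ^ Fintype.card {x // p x} := by
    let q : α → {x // p x} := fun x => if hx : p x then ⟨x, hx⟩ else ⟨τ x, (h x).2 hx⟩
    have hqf : ∀ x, q (f x) = q x := by
      intro x
      by_cases hx : p x <;> simp [q, f, hx, h, h']
    have hcard : Fintype.card {x // ¬ p x} = Fintype.card {x // p x} :=
      Fintype.card_congr
        { toFun := fun x => ⟨τ x.1, (h _).2 x.2⟩
          invFun := fun x => ⟨τ.symm x.1, fun hx => (h' _).1 hx x.2⟩
          left_inv := fun x => by simp
          right_inv := fun x => by simp }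
    rw [sign_eq_neg_one_pow_of_sameCycle_iff hf.toPerm q (fun x => ⟨x.1, by simp [q, x.2]⟩),
      ← Fintype.card_congr (Equiv.sumCompl p), Fintype.card_sum, hcard, pow_add, pow_add,
      ← pow_add, ← two_mul, pow_mul]
    · simp
    · intro x y
      constructor
      · rintro ⟨n, rfl⟩
        have : ∀ m : ℕ, ∀ z, q ((hf.toPerm ^ m) z) = q z := by
          intro m
          induction m with
          | zero => simp
          | succ m ih => intro z; rw [pow_succ, Equiv.Perm.mul_apply, ih]; exact hqf z
        obtain ⟨m, rfl | rfl⟩ := n.eq_nat_or_neg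
        · simp [this]
        · have := this m ((hf.toPerm ^ (-(m : ℤ))) x)
          rw [← this]; simp
      · intro hxy
        have key : ∀ z, hf.toPerm.SameCycle z (q z) := by
          intro z
          by_cases hz : p z
          · simp only [q, hz, dite_true]; exact Equiv.Perm.SameCycle.rfl
          · exact ⟨1, by simp [q, f, hz]⟩
        exact (key x).trans (hxy ▸ (key y).symm)
  have hmul : Equiv.Perm.sign (hf.toPerm * τ) =
      Equiv.Perm.sign ((τ * τ).subtypePerm (sq_preserves h)) := by
    refine (Equiv.Perm.sign_subtypePerm (p := p) (hf.toPerm * τ) ?_ ?_).symm.trans ?_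
    · intro x
      by_cases hx : p x <;> simp [f, h, hx]
    · intro x hx
      by_contra hn
      exact hx (by simp [f, h, hn])
    · have hsub : (hf.toPerm * τ).subtypePerm (p := p) (by
          intro x
          by_cases hx : p x <;> simp [f, h, hx]) = (τ * τ).subtypePerm (sq_preserves h) := by
        ext x
        simp [f, h, x.2]
      rw [hsub]
      congr!
  rw [map_mul, hsf] at hmul
  rw [← hmul, ← mul_assoc, ← mul_pow]; simp

theorem eq_of_sameCycle {α β : Type*} {σ : Equiv.Perm α} {q : α → β} (h : ∀ x, q (σ x) = q x)
    {x y : α} (hxy : σ.SameCycle x y) : q x = q y := by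
  obtain ⟨n, rfl⟩ := hxy
  have hnat : ∀ (m : ℕ) (z : α), q ((σ ^ m) z) = q z := by
    intro m
    induction m with
    | zero => simp
    | succ m ih => intro z; rw [pow_succ, Equiv.Perm.mul_apply, ih, h]
  obtain ⟨m, rfl | rfl⟩ := n.eq_nat_or_neg
  · simp [hnat]
  · rw [← hnat m ((σ ^ (-(m : ℤ))) x)]
    simp

/-! ### Faces and connected components of a rotation system -/

section General

variable {V : Type*} {G : SimpleGraph V}

@[simp] theorem dart_symm_fst (d : G.Dart) : d.symm.fst = d.snd := rfl

@[simp] theorem dart_symm_snd (d : G.Dart) : d.symm.snd = d.fst := rfl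

theorem eq_of_connectedComponentMk_eq {β : Type*} {g : V → β} (h : ∀ u v, G.Adj u v → g u = g v)
    {u v : V} (huv : G.connectedComponentMk u = G.connectedComponentMk v) : g u = g v := by
  obtain ⟨p⟩ := SimpleGraph.ConnectedComponent.eq.1 huv
  induction p with
  | nil => rfl
  | cons hadj p ih => exact (h _ _ hadj).trans (ih (SimpleGraph.ConnectedComponent.eq.2 ⟨p⟩))

namespace RotationSystem

variable (R : RotationSystem G)

theorem faceStep_apply (d : G.Dart) : R.faceStep d = R.rot d.symm := rfl

theorem faceStep_fst (d : G.Dart) : (R.faceStep d).fst = d.snd := R.fst_rot _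

theorem faceOf_eq_iff {d d' : G.Dart} : R.faceOf d = R.faceOf d' ↔ R.faceStep.SameCycle d d' :=
  Quotient.eq

theorem faceOf_surjective : Function.Surjective R.faceOf := Quotient.mk_surjective

theorem faceOf_faceStep (d : G.Dart) : R.faceOf (R.faceStep d) = R.faceOf d :=
  R.faceOf_eq_iff.2 (Equiv.Perm.sameCycle_apply_left.2 Equiv.Perm.SameCycle.rfl)

theorem faceOf_rot (d : G.Dart) : R.faceOf (R.rot d) = R.faceOf d.symm := by
  rw [← R.faceOf_faceStep d.symm, faceStep_apply, SimpleGraph.Dart.symm_symm]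

theorem connectedComponentMk_eq_of_faceOf_eq {d d' : G.Dart} (h : R.faceOf d = R.faceOf d') :
    G.connectedComponentMk d.fst = G.connectedComponentMk d'.fst :=
  eq_of_sameCycle (q := fun d : G.Dart => G.connectedComponentMk d.fst)
    (fun d => by
      rw [R.faceStep_fst]
      exact (SimpleGraph.ConnectedComponent.eq.2 d.adj.reachable).symm) (R.faceOf_eq_iff.1 h)

/-- The connected component of the graph that a face belongs to. -/
def faceComponent : R.Face → G.ConnectedComponent :=
  Quotient.lift (fun d : G.Dart => G.connectedComponentMk d.fst)
    fun _ _ h => R.connectedComponentMk_eq_of_faceOf_eq (Quotient.sound h)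

instance [Finite V] : Finite G.Dart :=
  Finite.of_injective _ SimpleGraph.Dart.toProd_injective

instance [Finite V] : Finite R.Face := inferInstanceAs (Finite (Quotient _))

noncomputable instance [Finite V] : Fintype R.Face := Fintype.ofFinite _

end RotationSystem

theorem sum_ncard_fiber {α C : Type*} [Fintype α] [Fintype C] (q : α → C) :
    ∑ c, {a | q a = c}.ncard = Fintype.card α := by
  classical
  rw [← Finset.card_univ, Finset.card_eq_sum_card_fiberwise (f := q) (t := Finset.univ) (by simp)]
  refine Finset.sum_congr rfl fun c _ => ?_
  rw [← Set.ncard_coe_finset]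
  simp

end General

/-! ### Euler's formula and potentials on the faces -/

section Bipartite

variable {B W : Type*} {G : SimpleGraph (B ⊕ W)}

/-- The dart of an edge that goes from its black end to its white end. -/
def Edge.dart (e : Edge G) : G.Dart := ⟨(Sum.inl e.black, Sum.inr e.white), e.2⟩

theorem Edge.ext_ends {e e' : Edge G} (hb : e.black = e'.black) (hw : e.white = e'.white) :
    e = e' :=
  Subtype.ext (Prod.ext hb hw)

@[simp] theorem Edge.dart_fst (e : Edge G) : e.dart.fst = Sum.inl e.black := rfl

@[simp] theorem Edge.dart_snd (e : Edge G) : e.dart.snd = Sum.inr e.white := rfl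

theorem Edge.dart_injective : Function.Injective (Edge.dart : Edge G → G.Dart) := by
  intro e e' h
  have h1 := congrArg (fun d : G.Dart => d.fst) h
  have h2 := congrArg (fun d : G.Dart => d.snd) h
  exact Edge.ext_ends (Sum.inl.inj h1) (Sum.inr.inj h2)

theorem exists_eq_dart_or_symm
    (hG : G.IsBipartiteWith (Set.range Sum.inl) (Set.range Sum.inr))
    (d : G.Dart) : ∃ e : Edge G, d = e.dart ∨ d = e.dart.symm := by
  rcases d with ⟨⟨u, v⟩, h⟩
  rcases hG.mem_of_adj h with ⟨⟨b, rfl⟩, w, rfl⟩ | ⟨⟨w, rfl⟩, b, rfl⟩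
  · exact ⟨⟨(b, w), h⟩, Or.inl rfl⟩
  · exact ⟨⟨(b, w), h.symm⟩, Or.inr rfl⟩

/-- A dart of a bipartite graph is an edge with a direction. -/
noncomputable def dartEquiv
    (hG : G.IsBipartiteWith (Set.range Sum.inl) (Set.range Sum.inr)) :
    Edge G ⊕ Edge G ≃ G.Dart :=
  Equiv.ofBijective (Sum.elim Edge.dart fun e => e.dart.symm) <| by
    constructor
    · rintro (e | e) (e' | e') h
      · exact congrArg _ (Edge.dart_injective h)
      · have := congrArg (fun d : G.Dart => d.fst) h
        simp at this
      · have := congrArg (fun d : G.Dart => d.fst) h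
        simp at this
      · exact congrArg _ (Edge.dart_injective (SimpleGraph.Dart.symm_involutive.injective h))
    · intro d
      obtain ⟨e, rfl | rfl⟩ := exists_eq_dart_or_symm hG d
      · exact ⟨Sum.inl e, rfl⟩
      · exact ⟨Sum.inr e, rfl⟩

open Classical in
theorem sum_dart [Fintype B] [Fintype W] {A : Type*} [AddCommMonoid A]
    (hG : G.IsBipartiteWith (Set.range Sum.inl) (Set.range Sum.inr)) (f : G.Dart → A) :
    ∑ d, f d = ∑ e : Edge G, (f e.dart + f e.dart.symm) := by
  rw [← (dartEquiv hG).sum_comp, Fintype.sum_sum_type, Finset.sum_add_distrib]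
  rfl

theorem black_fst_iff (hG : G.IsBipartiteWith (Set.range Sum.inl) (Set.range Sum.inr))
    (d : G.Dart) : d.snd.isLeft ↔ ¬ d.fst.isLeft := by
  obtain ⟨e, rfl | rfl⟩ := exists_eq_dart_or_symm hG d <;> simp

open Classical in
/-- Euler's formula for a planar graph without isolated vertices. -/
theorem RotationSystem.IsPlanar.euler [Fintype B] [Fintype W] {R : RotationSystem G}
    (hR : R.IsPlanar) (hG : G.IsBipartiteWith (Set.range Sum.inl) (Set.range Sum.inr))
    (hd : ∀ v, ∃ d : G.Dart, d.fst = v) :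
    (Fintype.card (B ⊕ W) : ℤ) - Fintype.card (Edge G) + Fintype.card R.Face =
      2 * Fintype.card G.ConnectedComponent := by
  have hV := sum_ncard_fiber G.connectedComponentMk
  have hE := sum_ncard_fiber fun e : Edge G => G.connectedComponentMk (Sum.inl e.black)
  have hF := sum_ncard_fiber R.faceComponent
  rw [← hV, ← hE, ← hF]
  push_cast
  rw [← Finset.sum_sub_distrib, ← Finset.sum_add_distrib, ← Finset.card_univ, mul_comm,
    ← nsmul_eq_mul, ← Finset.sum_const]
  refine Finset.sum_congr rfl fun c _ => ?_
  -- Planarity says nothing about isolated vertices; `hd` excludes them.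
  have hc : ∃ d : G.Dart, d.fst ∈ c.supp := by
    obtain ⟨v, rfl⟩ := c.exists_rep
    obtain ⟨d, rfl⟩ := hd v
    exact ⟨d, rfl⟩
  rw [← hR c hc]
  have h1 : {v | G.connectedComponentMk v = c} = c.supp := rfl
  have h3 : {f | R.faceComponent f = c} = {f | ∃ d : G.Dart, R.faceOf d = f ∧ d.fst ∈ c.supp} := by
    ext f
    constructor
    · rintro rfl
      obtain ⟨d, rfl⟩ := R.faceOf_surjective f
      exact ⟨d, rfl, rfl⟩
    · rintro ⟨d, rfl, h⟩
      exact h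
  have h2 : {e : Sym2 (B ⊕ W) | e ∈ G.edgeSet ∧ ∃ v ∈ e, v ∈ c.supp} =
      (fun e : Edge G => s(Sum.inl e.black, Sum.inr e.white)) ''
        {e : Edge G | G.connectedComponentMk (Sum.inl e.black) = c} := by
    have hmk : ∀ e : Edge G, G.connectedComponentMk (Sum.inr e.white) =
        G.connectedComponentMk (Sum.inl e.black) := fun e =>
      (SimpleGraph.ConnectedComponent.eq.2 e.dart.adj.reachable).symm
    ext s
    constructor
    · rintro ⟨hs, v, hv, hvc⟩
      induction s with
      | _ x y =>
        obtain ⟨e, he | he⟩ := exists_eq_dart_or_symm hG ⟨(x, y), hs⟩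
        all_goals
          have hx := congrArg (fun d : G.Dart => d.fst) he
          have hy := congrArg (fun d : G.Dart => d.snd) he
          simp only [dart_symm_fst, dart_symm_snd, Edge.dart_fst,
            Edge.dart_snd] at hx hy
          subst hx hy
          refine ⟨e, ?_, by simp [Sym2.eq_swap]⟩
          rcases Sym2.mem_iff.1 hv with rfl | rfl
          · first | exact hvc | exact (hmk e).symm.trans hvc
          · first | exact hvc | exact (hmk e).symm.trans hvc
    · rintro ⟨e, he, rfl⟩
      exact ⟨e.2, _, Sym2.mem_mk_left _ _, he⟩
  have hinj : Function.Injective fun e : Edge G => s((Sum.inl e.black : B ⊕ W), Sum.inr e.white) := by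
    intro e e' h
    rcases Sym2.eq_iff.1 h with ⟨h, h'⟩ | ⟨h, h'⟩
    · exact Edge.ext_ends (Sum.inl.inj h) (Sum.inr.inj h')
    · cases h
  rw [h1, h2, h3, Set.ncard_image_of_injective _ hinj]

open Classical in
/-- The matrix of the difference map from functions on a set to functions on the edges that sends
`g` to `e ↦ g (s e) - g (t e)`. -/
noncomputable def differenceMatrix {E X : Type*} (s t : E → X) : Matrix E X ℚ :=
  Matrix.of fun e x => (if s e = x then 1 else 0) - (if t e = x then 1 else 0)

theorem differenceMatrix_mulVec {E X : Type*} [Fintype X] (s t : E → X) (g : X → ℚ) (e : E) :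
    (differenceMatrix s t).mulVec g e = g (s e) - g (t e) := by
  classical
  simp [differenceMatrix, Matrix.mulVec, dotProduct, sub_mul, Finset.sum_sub_distrib,
    Finset.sum_ite_eq]

/-- The rank of a difference map whose kernel consists of the functions that factor through a
surjection `q : X → C`. -/
theorem rank_differenceMatrix_add_card {E X C : Type*} [Fintype E] [Fintype X] [Fintype C]
    (s t : E → X) (q : X → C) (hq : Function.Surjective q) (hst : ∀ e, q (s e) = q (t e))
    (h : ∀ g : X → ℚ, (∀ e, g (s e) = g (t e)) → ∀ x y, q x = q y → g x = g y) :
    (differenceMatrix s t).rank + Fintype.card C = Fintype.card X := by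
  classical
  have hker : LinearMap.ker (differenceMatrix s t).mulVecLin =
      LinearMap.range (LinearMap.funLeft ℚ ℚ q) := by
    ext g
    rw [LinearMap.mem_ker, LinearMap.mem_range]
    constructor
    · intro hg
      have hg' : ∀ e, g (s e) = g (t e) := fun e => by
        have := congrFun hg e
        rw [Matrix.mulVecLin_apply, differenceMatrix_mulVec] at this
        exact sub_eq_zero.1 this
      refine ⟨fun c => g (Function.surjInv hq c), funext fun x => ?_⟩
      exact h g hg' _ _ (Function.surjInv_eq hq _)
    · rintro ⟨g, rfl⟩
      ext e
      rw [Matrix.mulVecLin_apply, differenceMatrix_mulVec]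
      simp [LinearMap.funLeft_apply, hst]
  have h1 := LinearMap.finrank_range_add_finrank_ker (differenceMatrix s t).mulVecLin
  rw [hker, LinearMap.finrank_range_of_inj (LinearMap.funLeft_injective_of_surjective ℚ ℚ q hq)] at h1
  simpa [Matrix.rank] using h1

open Classical in
/-- In a planar graph without isolated vertices, a function on the edges that is orthogonal to all
gradients is the boundary of a function on the faces. -/
theorem RotationSystem.IsPlanar.exists_rat_potential [Fintype B] [Fintype W] {R : RotationSystem G}
    (hR : R.IsPlanar) (hG : G.IsBipartiteWith (Set.range Sum.inl) (Set.range Sum.inr))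
    (hd : ∀ v, ∃ d : G.Dart, d.fst = v) (c : Edge G → ℚ)
    (hc : ∀ g : B ⊕ W → ℚ, ∑ e, c e * (g (Sum.inl e.black) - g (Sum.inr e.white)) = 0) :
    ∃ f : R.Face → ℚ, ∀ e, c e = f (R.faceOf e.dart) - f (R.faceOf e.dart.symm) := by
  have hadj : ∀ e : Edge G, G.connectedComponentMk (Sum.inl e.black) =
      G.connectedComponentMk (Sum.inr e.white) := fun e =>
    SimpleGraph.ConnectedComponent.eq.2 e.dart.adj.reachable
  have hD := rank_differenceMatrix_add_card (fun e : Edge G => (Sum.inl e.black : B ⊕ W))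
    (fun e => Sum.inr e.white) G.connectedComponentMk (Quot.mk_surjective) hadj (by
      intro g hg u v huv
      refine eq_of_connectedComponentMk_eq (fun u v huv => ?_) huv
      obtain ⟨e, he | he⟩ := exists_eq_dart_or_symm hG ⟨(u, v), huv⟩
      · rw [show u = _ from congrArg (fun d : G.Dart => d.fst) he,
          show v = _ from congrArg (fun d : G.Dart => d.snd) he]
        exact hg e
      · rw [show u = _ from congrArg (fun d : G.Dart => d.fst) he,
          show v = _ from congrArg (fun d : G.Dart => d.snd) he]
        exact (hg e).symm)
  have hP := rank_differenceMatrix_add_card (fun e : Edge G => R.faceOf e.dart)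
    (fun e => R.faceOf e.dart.symm) R.faceComponent (by
      intro c
      obtain ⟨v, rfl⟩ := c.exists_rep
      obtain ⟨d, rfl⟩ := hd v
      exact ⟨R.faceOf d, rfl⟩) hadj (by
      intro g hg
      -- A function on the faces that agrees across every edge takes one value on all faces around a
      -- vertex, because rotation leads from a face to a neighbour across an edge. It therefore
      -- descends to the vertices and is constant on each component.
      have hsymm : ∀ d : G.Dart, g (R.faceOf d) = g (R.faceOf d.symm) := by
        intro d
        obtain ⟨e, rfl | rfl⟩ := exists_eq_dart_or_symm hG d
        · exact hg e
        · exact (hg e).symm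
      have hfst : ∀ d d' : G.Dart, d.fst = d'.fst → g (R.faceOf d) = g (R.faceOf d') := by
        intro d d' h
        refine eq_of_sameCycle (q := fun d => g (R.faceOf d)) (fun d => ?_) (R.sameCycle_rot d d' h)
        rw [R.faceOf_rot]
        exact (hsymm d).symm
      choose a ha using hd
      intro x y hxy
      obtain ⟨d, rfl⟩ := R.faceOf_surjective x
      obtain ⟨d', rfl⟩ := R.faceOf_surjective y
      have := eq_of_connectedComponentMk_eq (g := fun v => g (R.faceOf (a v))) (fun u v huv => by
        rw [hfst (a u) ⟨(u, v), huv⟩ (ha u), hsymm]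
        exact hfst _ _ (ha v).symm) hxy
      rw [hfst d (a d.fst) (ha _).symm, this, hfst _ d' (ha _)])
  set D := differenceMatrix (fun e : Edge G => (Sum.inl e.black : B ⊕ W)) fun e => Sum.inr e.white
  set P := differenceMatrix (fun e : Edge G => R.faceOf e.dart) fun e => R.faceOf e.dart.symm
  have hmem : ∀ x : Edge G → ℚ, x ∈ LinearMap.ker D.transpose.mulVecLin ↔
      ∀ g : B ⊕ W → ℚ, ∑ e, x e * (g (Sum.inl e.black) - g (Sum.inr e.white)) = 0 := by
    intro x
    have hx : ∀ g : B ⊕ W → ℚ, ∑ e, x e * (g (Sum.inl e.black) - g (Sum.inr e.white)) =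
        dotProduct (D.transpose.mulVec x) g := by
      intro g
      rw [Matrix.mulVec_transpose, ← Matrix.dotProduct_mulVec]
      simp [dotProduct, D, differenceMatrix_mulVec]
    rw [LinearMap.mem_ker, Matrix.mulVecLin_apply]
    simp only [hx]
    exact ⟨fun h g => by simp [h], fun h => dotProduct_eq_zero_iff.1 h⟩
  -- A closed boundary walk enters each vertex as often as it leaves it, so it is orthogonal to
  -- gradients.
  have hle : LinearMap.range P.mulVecLin ≤ LinearMap.ker D.transpose.mulVecLin := by
    rintro _ ⟨f, rfl⟩
    rw [hmem]
    intro g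
    have h1 : ∑ d : G.Dart, f (R.faceOf d) * g d.snd = ∑ d : G.Dart, f (R.faceOf d) * g d.fst := by
      rw [← Equiv.sum_comp R.faceStep fun d => f (R.faceOf d) * g d.fst]
      simp only [R.faceOf_faceStep, R.faceStep_fst]
    rw [sum_dart hG, sum_dart hG, ← sub_eq_zero, ← Finset.sum_sub_distrib] at h1
    rw [← neg_eq_zero, ← h1, ← Finset.sum_neg_distrib]
    refine Finset.sum_congr rfl fun e _ => ?_
    rw [Matrix.mulVecLin_apply, differenceMatrix_mulVec]
    simp only [dart_symm_fst, dart_symm_snd, Edge.dart_fst, Edge.dart_snd]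
    ring
  -- With C the number of components, the left side has dimension F - C and the right side E - V +
  -- C; Euler's formula makes them equal.
  have heq : LinearMap.range P.mulVecLin = LinearMap.ker D.transpose.mulVecLin := by
    apply Submodule.eq_of_le_of_finrank_eq hle
    have h1 := LinearMap.finrank_range_add_finrank_ker D.transpose.mulVecLin
    have h2 : Module.finrank ℚ (LinearMap.range D.transpose.mulVecLin) = D.rank := by
      rw [← Matrix.rank_transpose]; rfl
    have h3 : Module.finrank ℚ (LinearMap.range P.mulVecLin) = P.rank := rfl
    have h4 : Module.finrank ℚ (Edge G → ℚ) = Fintype.card (Edge G) := by simp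
    have he := hR.euler hG hd
    rw [h2, h4] at h1
    rw [h3]
    zify at h1 hD hP ⊢
    linarith
  obtain ⟨f, hf⟩ := heq.symm ▸ (hmem c).2 hc
  refine ⟨f, fun e => ?_⟩
  rw [← hf, Matrix.mulVecLin_apply, differenceMatrix_mulVec]

-- Rounding down commutes with adding integers, so the floor of a rational potential has the same
-- integer differences across edges.
open Classical in
theorem RotationSystem.IsPlanar.exists_int_potential [Fintype B] [Fintype W] {R : RotationSystem G}
    (hR : R.IsPlanar) (hG : G.IsBipartiteWith (Set.range Sum.inl) (Set.range Sum.inr))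
    (hd : ∀ v, ∃ d : G.Dart, d.fst = v) (c : Edge G → ℤ)
    (hc : ∀ g : B ⊕ W → ℚ, ∑ e, (c e : ℚ) * (g (Sum.inl e.black) - g (Sum.inr e.white)) = 0) :
    ∃ f : R.Face → ℤ, ∀ e, c e = f (R.faceOf e.dart) - f (R.faceOf e.dart.symm) := by
  obtain ⟨f, hf⟩ := hR.exists_rat_potential hG hd _ hc
  refine ⟨fun x => ⌊f x⌋, fun e => ?_⟩
  have : f (R.faceOf e.dart) = f (R.faceOf e.dart.symm) + (c e : ℤ) := by rw [hf e]; ring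
  change c e = ⌊f _⌋ - ⌊f _⌋
  rw [this, Int.floor_add_intCast]
  ring

end Bipartite

/-! ### Regions bounded by two matchings -/

section General

variable {V : Type*} {G : SimpleGraph V}

/-- `a v` is the dart from `v` to its partner in a perfect matching. -/
structure IsMatching (a : V → G.Dart) : Prop where
  fst : ∀ v, (a v).fst = v
  symm : ∀ v, a (a v).snd = (a v).symm

theorem IsMatching.eq_symm_iff {a : V → G.Dart} (h : IsMatching a) (d : G.Dart) :
    d.symm = a d.symm.fst ↔ d = a d.fst := by
  have key : ∀ d : G.Dart, d = a d.fst → d.symm = a d.symm.fst := by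
    intro d hd
    rw [dart_symm_fst, hd, ← h.symm, ← hd]
  refine ⟨fun hd => ?_, key d⟩
  simpa using key _ hd

open Classical in
/-- The involution of the darts that exchanges `a v` and `b v` for each vertex `v`. -/
noncomputable def swapDarts {a b : V → G.Dart} (ha : IsMatching a) (hb : IsMatching b) :
    Equiv.Perm G.Dart :=
  Function.Involutive.toPerm (fun d => Equiv.swap (a d.fst) (b d.fst) d) <| by
    have hfst : ∀ d : G.Dart, (Equiv.swap (a d.fst) (b d.fst) d).fst = d.fst := by
      intro d
      rw [Equiv.swap_apply_def]
      split_ifs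
      exacts [hb.fst _, ha.fst _, rfl]
    intro d
    simp only [hfst, Equiv.swap_apply_self]

section

variable {a b : V → G.Dart} (ha : IsMatching a) (hb : IsMatching b)

open Classical in
theorem swapDarts_apply (d : G.Dart) :
    swapDarts ha hb d = Equiv.swap (a d.fst) (b d.fst) d := rfl

theorem swapDarts_self (d : G.Dart) : swapDarts ha hb (swapDarts ha hb d) = d :=
  Function.Involutive.toPerm_involutive _ d

theorem swapDarts_left (v : V) : swapDarts ha hb (a v) = b v := by
  classical
  rw [swapDarts_apply, ha.fst, Equiv.swap_apply_left]

theorem swapDarts_right (v : V) : swapDarts ha hb (b v) = a v := by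
  classical
  rw [swapDarts_apply, hb.fst, Equiv.swap_apply_right]

theorem swapDarts_of_iff {d : G.Dart} (h : d = a d.fst ↔ d = b d.fst) :
    swapDarts ha hb d = d := by
  classical
  rw [swapDarts_apply]
  by_cases hd : d = a d.fst
  · rw [← hd, ← h.1 hd, Equiv.swap_self]; rfl
  · exact Equiv.swap_apply_of_ne_of_ne hd fun h' => hd (h.2 h')

theorem swapDarts_fst (d : G.Dart) : (swapDarts ha hb d).fst = d.fst := by
  by_cases h1 : d = a d.fst
  · rw [h1, swapDarts_left, hb.fst, ha.fst]
  by_cases h2 : d = b d.fst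
  · rw [h2, swapDarts_right, hb.fst, ha.fst]
  rw [swapDarts_of_iff ha hb (by tauto)]

/-- Follow a dart, and then turn from one matching to the other if possible, or else turn back. -/
noncomputable def alternate : Equiv.Perm G.Dart := swapDarts ha hb * dartRev G

theorem alternate_apply (d : G.Dart) : alternate ha hb d = swapDarts ha hb d.symm := rfl

theorem alternate_fst (d : G.Dart) : (alternate ha hb d).fst = d.snd := swapDarts_fst ha hb _

theorem alternate_left (v : V) : alternate ha hb (a v) = b (a v).snd := by
  rw [alternate_apply, ← ha.symm, swapDarts_left]

theorem alternate_right (v : V) : alternate ha hb (b v) = a (b v).snd := by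
  rw [alternate_apply, ← hb.symm, swapDarts_right]

end

/-- A union of faces, given by the set `p` of the darts on the boundary walks of these faces, whose
boundary consists of the edges of the symmetric difference of two matchings. -/
structure IsRegion (R : RotationSystem G) (a b : V → G.Dart) (p : G.Dart → Prop) : Prop where
  left : IsMatching a
  right : IsMatching b
  faceStep_iff : ∀ d, p (R.faceStep d) ↔ p d
  symm_iff : ∀ d : G.Dart, (p d.symm ↔ p d) ↔ (d = a d.fst ↔ d = b d.fst)

namespace IsRegion

variable {R : RotationSystem G} {a b : V → G.Dart} {p : G.Dart → Prop} (h : IsRegion R a b p)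
include h

theorem rot_iff (d : G.Dart) : p (R.rot d) ↔ p d.symm := by
  rw [← h.faceStep_iff d.symm, R.faceStep_apply, SimpleGraph.Dart.symm_symm]

/-- In the rotation around `v`, membership in the region changes just after a dart of the symmetric
difference, and only there. The only such darts at `v` are `a v` and `b v`. -/
theorem left_iff_not_right [Finite V] {v : V} (hv : a v ≠ b v) : p (a v) ↔ ¬ p (b v) := by
  have hex : ∃ n, 0 < n ∧ ((R.rot ^ n) (a v) = a v ∨ (R.rot ^ n) (a v) = b v) :=
    ⟨orderOf R.rot, orderOf_pos _, Or.inl (by rw [pow_orderOf_eq_one]; rfl)⟩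
  classical
  obtain ⟨hn, hn'⟩ := Nat.find_spec hex
  have hfst : ∀ n, ((R.rot ^ n) (a v)).fst = v := by
    intro n
    induction n with
    | zero => exact h.left.fst v
    | succ n ih => rw [pow_succ', Equiv.Perm.mul_apply, R.fst_rot, ih]
  have key : ∀ m, m + 1 ≤ Nat.find hex → (p ((R.rot ^ (m + 1)) (a v)) ↔ ¬ p (a v)) := by
    intro m
    induction m with
    | zero =>
      intro _
      have := h.symm_iff (a v)
      rw [h.left.fst] at this
      rw [zero_add, pow_one, h.rot_iff]
      tauto
    | succ m ih =>
      intro hm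
      rw [← ih (by omega), pow_succ', Equiv.Perm.mul_apply, h.rot_iff]
      refine (h.symm_iff _).2 ?_
      rw [hfst]
      have := Nat.find_min hex (m := m + 1) (by omega)
      push Not at this
      have := this (by omega)
      tauto
  obtain ⟨m, hm⟩ : ∃ m, Nat.find hex = m + 1 := ⟨Nat.find hex - 1, by omega⟩
  have := key m (by omega)
  rw [← hm] at this
  -- A return to `a v` before meeting `b v` is impossible: membership would have changed exactly
  -- once.
  rcases hn' with e | e <;> rw [e] at this <;> tauto

/-- Exactly one of two distinct darts `a v` and `b v` is in the region, so exchanging them changes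
membership, as reversing either one does. All other darts are fixed by the swap and have the same
membership as their reversals. -/
theorem swapDarts_iff [Finite V] (d : G.Dart) :
    p (swapDarts h.left h.right d) ↔ p d.symm := by
  by_cases hd : p d.symm ↔ p d
  · rw [swapDarts_of_iff _ _ ((h.symm_iff d).1 hd), hd]
  · have hd' := mt (h.symm_iff d).2 hd
    by_cases h1 : d = a d.fst
    · have hne : a d.fst ≠ b d.fst := by rw [← h1]; tauto
      have := h.left_iff_not_right hne
      rw [← h1] at this
      have h3 : swapDarts h.left h.right d = b d.fst := by
        conv_lhs => rw [h1]
        exact swapDarts_left _ _ _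
      rw [h3]
      tauto
    · have h2 : d = b d.fst := by tauto
      have hne : a d.fst ≠ b d.fst := by rw [← h2]; exact fun h' => h1 h'.symm
      have := h.left_iff_not_right hne
      rw [← h2] at this
      have h3 : swapDarts h.left h.right d = a d.fst := by
        conv_lhs => rw [h2]
        exact swapDarts_right _ _ _
      rw [h3]
      tauto

theorem alternate_iff [Finite V] (d : G.Dart) : p (alternate h.left h.right d) ↔ p d := by
  rw [alternate_apply, h.swapDarts_iff, SimpleGraph.Dart.symm_symm]

theorem alternate_symm_iff [Finite V] (d : G.Dart) :
    p (alternate h.left h.right d).symm ↔ p d.symm := by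
  rw [← h.swapDarts_iff, alternate_apply, swapDarts_self]

theorem alternate_of_iff {d : G.Dart} (hd : p d.symm ↔ p d) :
    alternate h.left h.right d = d.symm := by
  rw [alternate_apply, swapDarts_of_iff]
  rw [h.left.eq_symm_iff, h.right.eq_symm_iff, ← h.symm_iff, hd]

theorem rot_swapDarts_iff [Finite V] (d : G.Dart) :
    p ((R.rot * swapDarts h.left h.right) d) ↔ p d := by
  rw [Equiv.Perm.mul_apply, h.rot_iff, ← h.swapDarts_iff, swapDarts_self]

/-- The darts of the region at a vertex fill either the whole rotation or one sector of it. Where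
the rotation leaves the sector through one boundary dart, the swap jumps to the other boundary dart,
after which the rotation enters again. -/
theorem sameCycle_rot_swapDarts [Finite V] {d d' : G.Dart} (hd : p d) (hd' : p d')
    (hfst : d.fst = d'.fst) : (R.rot * swapDarts h.left h.right).SameCycle d d' := by
  classical
  obtain ⟨n, hn⟩ := (R.sameCycle_rot d d' hfst).exists_nat_pow_eq
  -- While the rotation is outside the region, `x` remembers the boundary dart through which it
  -- left.
  have key : ∀ n, ((R.rot ^ n) d).fst = d.fst ∧ (p ((R.rot ^ n) d) →
      (R.rot * swapDarts h.left h.right).SameCycle d ((R.rot ^ n) d)) ∧ (¬ p ((R.rot ^ n) d) →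
      ∃ x : G.Dart, x.fst = d.fst ∧ p x ∧ ¬ p x.symm ∧
        (R.rot * swapDarts h.left h.right).SameCycle d x) := by
    intro n
    induction n with
    | zero => exact ⟨rfl, fun _ => Equiv.Perm.SameCycle.rfl, fun hn => absurd hd hn⟩
    | succ n ih =>
      obtain ⟨ih1, ih2, ih3⟩ := ih
      rw [pow_succ', Equiv.Perm.mul_apply]
      generalize (R.rot ^ n) d = e at ih1 ih2 ih3 ⊢
      refine ⟨by rw [R.fst_rot, ih1], fun he => ?_, fun he => ?_⟩
      · rw [h.rot_iff] at he
        by_cases hpe : p e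
        · have := swapDarts_of_iff h.left h.right ((h.symm_iff e).1 (by tauto))
          refine (ih2 hpe).trans ⟨1, ?_⟩
          rw [zpow_one, Equiv.Perm.mul_apply, this]
        · obtain ⟨x, hx1, hx2, hx3, hx4⟩ := ih3 hpe
          refine hx4.trans ⟨1, ?_⟩
          rw [zpow_one, Equiv.Perm.mul_apply]
          congr 1
          have hce := mt (h.symm_iff e).2 (by tauto)
          have hcx := mt (h.symm_iff x).2 (by tauto)
          have hxe : x ≠ e := fun hxe => hpe (hxe ▸ hx2)
          rw [ih1] at hce
          rw [hx1] at hcx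
          rw [swapDarts_apply, hx1]
          by_cases hxa : x = a d.fst
          · have : e = b d.fst := by
              by_contra hne
              have : e = a d.fst := by tauto
              exact hxe (hxa.trans this.symm)
            rw [← this, ← hxa, Equiv.swap_apply_left]
          · have hxb : x = b d.fst := by tauto
            have : e = a d.fst := by
              by_contra hne
              have : e = b d.fst := by tauto
              exact hxe (hxb.trans this.symm)
            rw [← this, ← hxb, Equiv.swap_apply_right]
      · rw [h.rot_iff] at he
        by_cases hpe : p e
        · exact ⟨e, ih1, hpe, he, ih2 hpe⟩
        · exact ih3 hpe
  rw [← hn] at hd' ⊢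
  exact (key n).2.1 hd'

/-- If the matching edge at `v` had the region on neither side, it would belong to both matchings.
No boundary edge would then meet `v`, and one dart of the region at `v` would force all of them, `a
v` included, into the region. -/
theorem exists_snd [Finite V] {v : V} (hv : ∃ d : G.Dart, d.fst = v ∧ p d) :
    ∃ d : G.Dart, d.fst = (a v).snd ∧ p d := by
  by_cases h1 : p (a v)
  · exact ⟨R.faceStep (a v), R.faceStep_fst _, (h.faceStep_iff _).2 h1⟩
  by_cases h2 : p (a v).symm
  · exact ⟨(a v).symm, rfl, h2⟩
  obtain ⟨d, rfl, hd⟩ := hv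
  exfalso
  have hab := (h.symm_iff (a d.fst)).1 (by tauto)
  rw [h.left.fst] at hab
  have hab : a d.fst = b d.fst := hab.1 rfl
  have hrot : ∀ n, ((R.rot ^ n) d).fst = d.fst ∧ p ((R.rot ^ n) d) := by
    intro n
    induction n with
    | zero => exact ⟨rfl, hd⟩
    | succ n ih =>
      rw [pow_succ', Equiv.Perm.mul_apply, R.fst_rot, h.rot_iff, (h.symm_iff _).2]
      · exact ih
      · rw [ih.1, hab]
  obtain ⟨n, hn⟩ := (R.sameCycle_rot d (a d.fst) (h.left.fst _).symm).exists_nat_pow_eq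
  exact h1 (hn ▸ (hrot n).2)

/-- The matching `a` pairs these vertices without fixed points. -/
theorem even_card_vertices [Finite V] [Fintype {v : V // ∃ d : G.Dart, d.fst = v ∧ p d}] :
    (-1 : ℤˣ) ^ Fintype.card {v : V // ∃ d : G.Dart, d.fst = v ∧ p d} = 1 := by
  rw [← Finset.card_univ, ← Finset.prod_const]
  refine Finset.prod_involution (fun v _ => ⟨(a v.1).snd, h.exists_snd v.2⟩) ?_ ?_ ?_ ?_
  · simp
  · intro v _ _ hv
    have h1 := congrArg Subtype.val hv
    have h2 := (a v.1).adj
    rw [h.left.fst] at h2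
    exact h2.ne h1.symm
  · simp
  · intro v _
    apply Subtype.ext
    change (a (a v.1).snd).snd = v.1
    rw [h.left.symm, dart_symm_snd, h.left.fst]

/-- The parity of the number of faces of a region. -/
theorem neg_one_pow_card_faces [Finite V] [Fintype {d // p d}] [DecidableEq {d // p d}]
    (P : R.Face → Prop) [Fintype {f // P f}] (hP : ∀ d, p d ↔ P (R.faceOf d)) :
    (-1) ^ Fintype.card {f // P f} =
      Equiv.Perm.sign ((alternate h.left h.right).subtypePerm h.alternate_iff) := by
  have := Fintype.ofFinite {v : V // ∃ d : G.Dart, d.fst = v ∧ p d}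
  have h1 := sign_eq_neg_one_pow_of_sameCycle_iff (R.faceStep.subtypePerm h.faceStep_iff)
    (fun d => (⟨R.faceOf d.1, (hP _).1 d.2⟩ : {f // P f})) (by
      rintro ⟨f, hf⟩
      obtain ⟨d, rfl⟩ := R.faceOf_surjective f
      exact ⟨⟨d, (hP d).2 hf⟩, rfl⟩) (by
      intro x y
      rw [Equiv.Perm.sameCycle_subtypePerm, ← R.faceOf_eq_iff, Subtype.mk.injEq])
  have h2 := sign_eq_neg_one_pow_of_sameCycle_iff
    ((R.rot * swapDarts h.left h.right).subtypePerm h.rot_swapDarts_iff)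
    (fun d => (⟨d.1.fst, d.1, rfl, d.2⟩ : {v : V // ∃ d : G.Dart, d.fst = v ∧ p d})) (by
      rintro ⟨v, d, rfl, hd⟩
      exact ⟨⟨d, hd⟩, rfl⟩) (by
      intro x y
      rw [Equiv.Perm.sameCycle_subtypePerm, Subtype.mk.injEq]
      refine ⟨fun hxy => ?_, fun hxy => h.sameCycle_rot_swapDarts x.2 y.2 hxy⟩
      refine eq_of_sameCycle (q := fun d : G.Dart => d.fst) (fun d => ?_) hxy
      rw [Equiv.Perm.mul_apply, R.fst_rot, swapDarts_fst])
  -- The swap is an involution, so inserting it twice factors the face permutation. The cycles of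
  -- the product count faces, those of the first factor count vertices, and the number of darts
  -- cancels.
  have h3 : R.faceStep.subtypePerm h.faceStep_iff =
      (R.rot * swapDarts h.left h.right).subtypePerm h.rot_swapDarts_iff *
        (alternate h.left h.right).subtypePerm h.alternate_iff := by
    refine Equiv.ext fun d => Subtype.ext ?_
    change R.rot d.1.symm =
      R.rot (swapDarts h.left h.right (swapDarts h.left h.right d.1.symm))
    rw [swapDarts_self]
  rw [h3, map_mul, h2, pow_add, pow_add, h.even_card_vertices, mul_one] at h1
  exact (mul_left_cancel h1).symm

end IsRegion

end General
-- The sign of `alternate` and the permutation relating two matchings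
/-- Inverting a permutation on an invariant set does not change its sign. -/
theorem exists_perm_inv_on {α : Type*} [Fintype α] [DecidableEq α] (π : Equiv.Perm α)
    (q : α → Prop) (hq : ∀ x, q (π x) ↔ q x) :
    ∃ ρ : Equiv.Perm α, Equiv.Perm.sign ρ = Equiv.Perm.sign π ∧ (∀ x, q x → ρ x = π.symm x) ∧
      ∀ x, ¬ q x → ρ x = π x := by
  classical
  have hq' : ∀ x, q (π.symm x) ↔ q x := fun x => by rw [← hq, Equiv.apply_symm_apply]
  let κ : Equiv.Perm α := Equiv.Perm.ofSubtype (π.subtypePerm hq)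
  have h1 : ∀ x, q x → κ x = π x := fun x hx => by
    rw [Equiv.Perm.ofSubtype_apply_of_mem _ hx]; rfl
  have h2 : ∀ x, ¬ q x → κ x = x := fun x hx => Equiv.Perm.ofSubtype_apply_of_not_mem _ hx
  have h1' : ∀ x, q x → κ⁻¹ x = π.symm x := fun x hx => by
    rw [Equiv.Perm.inv_eq_iff_eq, h1 _ ((hq' x).2 hx), Equiv.apply_symm_apply]
  have h2' : ∀ x, ¬ q x → κ⁻¹ x = x := fun x hx => by
    rw [Equiv.Perm.inv_eq_iff_eq, h2 _ hx]
  -- Here `κ` is `π` on the invariant set and the identity elsewhere; dividing by its square inverts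
  -- `π` there and leaves the sign unchanged.
  refine ⟨π * κ⁻¹ * κ⁻¹, ?_, fun x hx => ?_, fun x hx => ?_⟩
  · rw [mul_assoc, map_mul, ← sq, map_pow, Int.units_sq, mul_one]
  · rw [Equiv.Perm.mul_apply, Equiv.Perm.mul_apply, h1' x hx, h1' _ ((hq' x).2 hx),
      Equiv.apply_symm_apply]
  · rw [Equiv.Perm.mul_apply, Equiv.Perm.mul_apply, h2' x hx, h2' x hx]

section Bipartite

variable {B W : Type*} {G : SimpleGraph (B ⊕ W)} {R : RotationSystem G}
  {a b : B ⊕ W → G.Dart} {p : G.Dart → Prop}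

/-- The square of `alternate` fixes interior darts, which are merely reversed twice. A black vertex
starts at most one boundary dart inside the region; the square moves it along `π` if it belongs to
`b`, and along the inverse of `π` if it belongs to `a`. Up to fixed points the square is thus `π`
inverted on an invariant set. -/
theorem IsRegion.sign_alternate [Fintype B] [DecidableEq B] [Finite W] [Fintype {d // p d}]
    [DecidableEq {d // p d}] (π : Equiv.Perm B)
    (h : IsRegion R a b p)
    (hG : G.IsBipartiteWith (Set.range Sum.inl) (Set.range Sum.inr))
    (hπ : ∀ x, (a (b (Sum.inl x)).snd).snd = Sum.inl (π x)) :
    Equiv.Perm.sign ((alternate h.left h.right).subtypePerm h.alternate_iff) =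
      (-1) ^ Fintype.card {d : {d // p d} // d.1.fst.isLeft} * Equiv.Perm.sign π := by
  set τ := alternate h.left h.right with hτ
  have hb2 : ∀ x, τ (τ (b (Sum.inl x))) = b (Sum.inl (π x)) := by
    intro x
    rw [hτ, alternate_right, alternate_left, hπ]
  have ha2 : ∀ x, τ (τ (a (Sum.inl (π x)))) = a (Sum.inl x) := by
    intro x
    have h1 : a (Sum.inl (π x)) = (a (b (Sum.inl x)).snd).symm := by
      rw [← hπ, h.left.symm]
    rw [hτ, alternate_left, h1, dart_symm_snd, h.left.fst, alternate_right, h.right.symm,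
      dart_symm_snd, h.right.fst]
  have ha2' : ∀ x, τ (τ (a (Sum.inl x))) = a (Sum.inl (π.symm x)) := by
    intro x
    rw [← ha2 (π.symm x), Equiv.apply_symm_apply]
  have hτp : ∀ d, p (τ d) ↔ p d := h.alternate_iff
  have hτs : ∀ d, p (τ d).symm ↔ p d.symm := h.alternate_symm_iff
  have hfix : ∀ d : G.Dart, p d → τ (τ d) ≠ d → ¬ p d.symm := by
    intro d hd hne hs
    apply hne
    have h1 : τ d = d.symm := h.alternate_of_iff (by tauto)
    have h2 : τ d.symm = d := by
      rw [hτ, h.alternate_of_iff] <;> rw [SimpleGraph.Dart.symm_symm]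
      tauto
    rw [h1, h2]
  have hcross : ∀ d : G.Dart, p d → ¬ p d.symm → ∀ v, d.fst = v →
      a v ≠ b v ∧ (d = a v ∧ p (a v) ∧ ¬ p (b v) ∨ d = b v ∧ p (b v) ∧ ¬ p (a v)) := by
    rintro d hd hs v rfl
    have h1 := mt (h.symm_iff d).2 (by tauto)
    by_cases hda : d = a d.fst
    · have hne : a d.fst ≠ b d.fst := by rw [← hda]; tauto
      have := h.left_iff_not_right hne
      refine ⟨hne, Or.inl ⟨hda, ?_⟩⟩
      rw [← hda] at this ⊢
      tauto
    · have hdb : d = b d.fst := by tauto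
      have hne : a d.fst ≠ b d.fst := by rw [← hdb]; exact fun h' => hda h'.symm
      have := h.left_iff_not_right hne
      refine ⟨hne, Or.inr ⟨hdb, ?_⟩⟩
      rw [← hdb] at this ⊢
      tauto
  obtain ⟨ρ, hρ, hρ1, hρ2⟩ := exists_perm_inv_on π
    (fun x => p (a (Sum.inl x)) ∧ ¬ p (a (Sum.inl x)).symm) (by
      intro x
      rw [← ha2 x, hτp, hτp, hτs, hτs])
  have hleft : ∀ d : {d // p d}, (τ.subtypePerm h.alternate_iff d).1.fst.isLeft ↔
      ¬ d.1.fst.isLeft := by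
    intro d
    change (alternate h.left h.right d.1).fst.isLeft ↔ _
    rw [alternate_fst, black_fst_iff hG]
  rw [sign_of_swaps (fun d : {d // p d} => (d.1.fst.isLeft : Prop)) _ hleft, ← hρ]
  congr 1
  have hinl : ∀ x : {d : {d // p d} // d.1.fst.isLeft}, Sum.inl (x.1.1.fst.getLeft x.2) = x.1.1.fst :=
    fun x => Sum.inl_getLeft _ _
  have hval : ∀ x : {d : {d // p d} // d.1.fst.isLeft},
      (((τ.subtypePerm h.alternate_iff * τ.subtypePerm h.alternate_iff).subtypePerm
        (sq_preserves hleft) x).1.1) = τ (τ x.1.1) := fun x => rfl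
  have hne : ∀ x : {d : {d // p d} // d.1.fst.isLeft},
      (τ.subtypePerm h.alternate_iff * τ.subtypePerm h.alternate_iff).subtypePerm
        (sq_preserves hleft) x ≠ x ↔ τ (τ x.1.1) ≠ x.1.1 := fun x => by
    rw [← hval, Ne, Ne, Subtype.ext_iff, Subtype.ext_iff]
  -- Only moved points have to correspond: each moved dart goes to its black starting vertex.
  refine Equiv.Perm.sign_bij (fun x _ => x.1.1.fst.getLeft x.2) ?_ ?_ ?_
  · intro x hx _
    apply Sum.inl_injective (β := W)
    rw [hinl, hval]
    rw [hne] at hx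
    have hs := hfix _ x.1.2 hx
    obtain ⟨v, hv⟩ : ∃ v, v = x.1.1.fst.getLeft x.2 := ⟨_, rfl⟩
    have hv' : x.1.1.fst = Sum.inl v := by rw [hv, hinl]
    rw [← hv]
    obtain ⟨-, ⟨hd, -, -⟩ | ⟨hd, -, hpa⟩⟩ := hcross _ x.1.2 hs _ hv'
    · rw [hρ1 v (hd ▸ ⟨x.1.2, hs⟩), hd]
      rw [ha2', h.left.fst]
    · rw [hρ2 v (by tauto), hd, hb2, h.right.fst]
  · intro x y hx hy hxy
    rw [hne] at hx hy
    have hxy' : x.1.1.fst = y.1.1.fst :=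
      (hinl x).symm.trans ((congrArg Sum.inl hxy).trans (hinl y))
    obtain ⟨-, h1⟩ := hcross _ x.1.2 (hfix _ x.1.2 hx) _ rfl
    obtain ⟨-, h2⟩ := hcross _ y.1.2 (hfix _ y.1.2 hy) _ hxy'.symm
    have : x.1.1 = y.1.1 := by
      rcases h1 with ⟨h1, h1', h1''⟩ | ⟨h1, h1', h1''⟩ <;>
      rcases h2 with ⟨h2, h2', h2''⟩ | ⟨h2, h2', h2''⟩
      · exact h1.trans h2.symm
      · exact absurd h1' h2''
      · exact absurd h1' h2''
      · exact h1.trans h2.symm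
    exact Subtype.ext (Subtype.ext this)
  · intro v hv
    by_cases hX : p (a (Sum.inl v)) ∧ ¬ p (a (Sum.inl v)).symm
    · rw [hρ1 v hX] at hv
      refine ⟨⟨⟨a (Sum.inl v), hX.1⟩, by rw [h.left.fst]; rfl⟩, ?_, ?_⟩
      · rw [hne]
        intro he
        have he' := congrArg (fun d : G.Dart => d.fst) ((ha2' v).symm.trans he)
        simp only [h.left.fst] at he'
        exact hv (Sum.inl_injective he')
      · apply Sum.inl_injective (β := W)
        rw [hinl, h.left.fst]
    · rw [hρ2 v hX] at hv
      have hab : a (Sum.inl v) ≠ b (Sum.inl v) := by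
        intro hab
        apply hv
        apply Sum.inl_injective (β := W)
        rw [← hπ, ← hab, h.left.symm, dart_symm_snd, h.left.fst]
      have hpb : p (b (Sum.inl v)) := by
        by_contra hpb
        have hpa : p (a (Sum.inl v)) := (h.left_iff_not_right hab).2 hpb
        have h1 := h.symm_iff (a (Sum.inl v))
        rw [h.left.fst] at h1
        tauto
      refine ⟨⟨⟨b (Sum.inl v), hpb⟩, by rw [h.right.fst]; rfl⟩, ?_, ?_⟩
      · rw [hne]
        intro he
        have he' := congrArg (fun d : G.Dart => d.fst) ((hb2 v).symm.trans he)
        simp only [h.right.fst] at he'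
        exact hv (Sum.inl_injective he')
      · apply Sum.inl_injective (β := W)
        rw [hinl, h.right.fst]

/-! ### Kasteleyn weights along perfect matchings -/

/-- The edge at the black vertex `x` of the perfect matching that is given by a bijection. -/
def edgeOf (σ : B ≃ W) (hσ : ∀ x, G.Adj (Sum.inl x) (Sum.inr (σ x))) (x : B) : Edge G :=
  ⟨(x, σ x), hσ x⟩

/-- The darts of the perfect matching that is given by a bijection. -/
def matchingDarts (σ : B ≃ W) (hσ : ∀ x, G.Adj (Sum.inl x) (Sum.inr (σ x))) : B ⊕ W → G.Dart :=
  Sum.elim (fun x => (edgeOf σ hσ x).dart) fun y => (edgeOf σ hσ (σ.symm y)).dart.symm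

theorem edgeOf_eq_iff {σ : B ≃ W} {hσ : ∀ x, G.Adj (Sum.inl x) (Sum.inr (σ x))} {e : Edge G} :
    edgeOf σ hσ e.black = e ↔ σ e.black = e.white :=
  ⟨fun h => congrArg Edge.white h, fun h => Edge.ext_ends rfl h⟩

theorem isMatching_matchingDarts (σ : B ≃ W) (hσ : ∀ x, G.Adj (Sum.inl x) (Sum.inr (σ x))) :
    IsMatching (matchingDarts σ hσ) where
  fst := by
    rintro (x | y)
    · rfl
    · exact congrArg Sum.inr (σ.apply_symm_apply y)
  symm := by
    rintro (x | y)
    · change (edgeOf σ hσ (σ.symm (σ x))).dart.symm = _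
      rw [σ.symm_apply_apply]; rfl
    · change _ = (edgeOf σ hσ (σ.symm y)).dart.symm.symm
      rw [SimpleGraph.Dart.symm_symm]; rfl

theorem dart_eq_matchingDarts_iff {σ : B ≃ W} {hσ : ∀ x, G.Adj (Sum.inl x) (Sum.inr (σ x))}
    {e : Edge G} : e.dart = matchingDarts σ hσ e.dart.fst ↔ σ e.black = e.white := by
  rw [← edgeOf_eq_iff (hσ := hσ)]
  exact ⟨fun h => (Edge.dart_injective h).symm, fun h => congrArg Edge.dart h.symm⟩

open Classical in
theorem sum_edge_ite [Fintype B] [Fintype W] {A : Type*} [AddCommMonoid A] (σ : B ≃ W)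
    (hσ : ∀ x, G.Adj (Sum.inl x) (Sum.inr (σ x))) (F : Edge G → A) :
    ∑ e : Edge G, (if σ e.black = e.white then F e else 0) = ∑ x, F (edgeOf σ hσ x) := by
  rw [← Finset.sum_filter]
  refine Finset.sum_bij' (fun e _ => e.black) (fun x _ => edgeOf σ hσ x) ?_ ?_ ?_ ?_ ?_
  · simp
  · intro x _
    exact Finset.mem_filter.2 ⟨Finset.mem_univ _, rfl⟩
  · intro e he
    exact edgeOf_eq_iff.2 (Finset.mem_filter.1 he).2
  · intro x _
    rfl
  · intro e he
    rw [edgeOf_eq_iff.2 (Finset.mem_filter.1 he).2]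

open Classical in
theorem prod_edge_ite [Fintype B] [Fintype W] {A : Type*} [CommMonoid A] (σ : B ≃ W)
    (hσ : ∀ x, G.Adj (Sum.inl x) (Sum.inr (σ x))) (F : Edge G → A) :
    ∏ e : Edge G, (if σ e.black = e.white then F e else 1) = ∏ x, F (edgeOf σ hσ x) :=
  sum_edge_ite (A := Additive A) σ hσ F

open Classical in
theorem prod_dart [Fintype B] [Fintype W] {A : Type*} [CommMonoid A]
    (hG : G.IsBipartiteWith (Set.range Sum.inl) (Set.range Sum.inr)) (f : G.Dart → A) :
    ∏ d, f d = ∏ e : Edge G, (f e.dart * f e.dart.symm) :=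
  sum_dart (A := Additive A) hG f

open Classical in
theorem RotationSystem.mem_faceDarts [Fintype B] [Fintype W] (R : RotationSystem G)
    {d d₀ : G.Dart} : d ∈ R.faceDarts d₀ ↔ R.faceOf d = R.faceOf d₀ := by
  simp [faceDarts]

open Classical in
/-- A sign for each dart, which is negative for the darts that start at a black vertex. -/
noncomputable def colourSign (d : G.Dart) : ℂ := if d.fst.isLeft then -1 else 1

-- The face permutation exchanges darts starting at black vertices with darts starting at white
-- ones.
open Classical in
theorem card_faceDarts [Fintype B] [Fintype W] (R : RotationSystem G)
    (hG : G.IsBipartiteWith (Set.range Sum.inl) (Set.range Sum.inr)) (d₀ : G.Dart) :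
    (R.faceDarts d₀).card = 2 * ((R.faceDarts d₀).filter fun d => d.fst.isLeft).card := by
  rw [← Finset.card_filter_add_card_filter_not (fun d : G.Dart => (d.fst.isLeft : Prop)), two_mul]
  congr 1
  refine (Finset.card_bij (fun d _ => R.faceStep d) ?_ ?_ ?_).symm
  · intro d hd
    rw [Finset.mem_filter, R.mem_faceDarts] at hd ⊢
    rw [R.faceOf_faceStep, R.faceStep_fst, black_fst_iff hG]
    exact ⟨hd.1, not_not.2 hd.2⟩
  · exact fun d _ d' _ h => R.faceStep.injective h
  · intro d hd
    refine ⟨R.faceStep.symm d, ?_, Equiv.apply_symm_apply _ _⟩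
    rw [Finset.mem_filter, R.mem_faceDarts] at hd ⊢
    have h1 := R.faceOf_faceStep (R.faceStep.symm d)
    have h2 := black_fst_iff hG (R.faceStep.symm d)
    rw [← R.faceStep_fst] at h2
    rw [Equiv.apply_symm_apply] at h1 h2
    exact ⟨h1.symm.trans hd.1, by tauto⟩

theorem norm_dartFactor {ε : Edge G → ℂ} (hε : ∀ e, ‖ε e‖ = 1) (d : G.Dart) :
    ‖dartFactor ε d‖ = 1 := by
  rcases d with ⟨⟨u | u, v | v⟩, h⟩ <;> simp [dartFactor, hε]

-- A face of 2n edges has n darts starting at black vertices, so both cases of the Kasteleyn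
-- condition ask for the sign of -(-1)^n; modulus one then fixes the value.
open Classical in
theorem IsKasteleynWeighting.alternatingProduct_eq [Fintype B] [Fintype W] {R : RotationSystem G}
    {ε : Edge G → ℂ} (hε : IsKasteleynWeighting R ε)
    (hG : G.IsBipartiteWith (Set.range Sum.inl) (Set.range Sum.inr)) (d₀ : G.Dart) :
    alternatingProduct R ε d₀ = -∏ d ∈ R.faceDarts d₀, colourSign d := by
  have hcard := card_faceDarts R hG d₀
  have hnorm : ‖alternatingProduct R ε d₀‖ = 1 := by
    rw [alternatingProduct, norm_prod]
    exact Finset.prod_eq_one fun d _ => norm_dartFactor hε.norm_eq_one d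
  have hprod : ∏ d ∈ R.faceDarts d₀, (colourSign d : ℂ) =
      (-1) ^ ((R.faceDarts d₀).filter fun d => d.fst.isLeft).card := by
    simp [colourSign, Finset.prod_ite]
  rw [hprod]
  set n := ((R.faceDarts d₀).filter fun d => d.fst.isLeft).card
  rcases Nat.even_or_odd n with hn | hn
  · obtain ⟨r, hr, h⟩ := hε.neg_of_mod_four_eq_zero d₀ (by obtain ⟨m, hm⟩ := hn; omega)
    rw [h, Complex.norm_real, Real.norm_of_nonpos hr.le] at hnorm
    rw [h, hn.neg_one_pow, show r = -1 by linarith]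
    simp
  · obtain ⟨r, hr, h⟩ := hε.pos_of_mod_four_eq_two d₀ (by obtain ⟨m, hm⟩ := hn; omega)
    rw [h, Complex.norm_real, Real.norm_of_nonneg hr.le] at hnorm
    rw [h, hn.neg_one_pow, hnorm]
    simp

theorem neg_one_zpow_eq_ite (k : ℤ) [Decidable (Odd k)] :
    (-1 : ℂ) ^ k = if Odd k then -1 else 1 := by
  split_ifs with h
  · exact h.neg_one_zpow
  · exact (Int.not_odd_iff_even.1 h).neg_one_zpow

open Classical in
theorem prod_neg_one_zpow {X : Type*} [Fintype X] (f : X → ℤ) :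
    ∏ x, (-1 : ℂ) ^ f x = (-1) ^ Fintype.card {x // Odd (f x)} := by
  simp [neg_one_zpow_eq_ite, Finset.prod_ite, Fintype.card_subtype]

open Classical in
theorem prod_fiber_zpow [Fintype B] [Fintype W] (R : RotationSystem G) (f : R.Face → ℤ)
    (s : G.Dart → ℂ) :
    ∏ d, s d ^ f (R.faceOf d) = ∏ F, (∏ d ∈ Finset.univ.filter (fun d => R.faceOf d = F), s d) ^ f F := by
  rw [← Finset.prod_fiberwise Finset.univ R.faceOf]
  refine Finset.prod_congr rfl fun F _ => ?_
  rw [← Finset.prod_zpow]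
  refine Finset.prod_congr rfl fun d hd => ?_
  rw [(Finset.mem_filter.1 hd).2]

open Classical in
/-- The product of the Kasteleyn weights along a perfect matching changes by the sign of the
permutation that relates two matchings. -/
theorem IsKasteleynWeighting.sign_mul_prod [Fintype B] [Fintype W] [DecidableEq B]
    {R : RotationSystem G}
    {ε : Edge G → ℂ} (hε : IsKasteleynWeighting R ε) (hR : R.IsPlanar)
    (hG : G.IsBipartiteWith (Set.range Sum.inl) (Set.range Sum.inr)) (σ₀ σ₁ : B ≃ W)
    (h₀ : ∀ x, G.Adj (Sum.inl x) (Sum.inr (σ₀ x))) (h₁ : ∀ x, G.Adj (Sum.inl x) (Sum.inr (σ₁ x))) :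
    ((Equiv.Perm.sign (σ₁.trans σ₀.symm) : ℤ) : ℂ) * ∏ x, ε (edgeOf σ₁ h₁ x) =
      ∏ x, ε (edgeOf σ₀ h₀ x) := by
  have hm₀ := isMatching_matchingDarts σ₀ h₀
  have hm₁ := isMatching_matchingDarts σ₁ h₁
  have hne : ∀ e, ε e ≠ 0 := fun e h => by simpa [h] using hε.norm_eq_one e
  let c : Edge G → ℤ := fun e =>
    (if σ₁ e.black = e.white then 1 else 0) - (if σ₀ e.black = e.white then 1 else 0)
  obtain ⟨f, hf⟩ := hR.exists_int_potential hG (fun v => ⟨_, hm₀.fst v⟩) c (by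
    intro g
    -- The pairing of the indicator of a cover with a gradient does not depend on the cover, so the
    -- difference `c` pairs to zero.
    have key : ∀ (σ : B ≃ W) (hσ : ∀ x, G.Adj (Sum.inl x) (Sum.inr (σ x))),
        ∑ e : Edge G, (if σ e.black = e.white then (g (Sum.inl e.black) - g (Sum.inr e.white)) else 0)
          = ∑ x, g (Sum.inl x) - ∑ y, g (Sum.inr y) := by
      intro σ hσ
      rw [sum_edge_ite σ hσ fun e => g (Sum.inl e.black) - g (Sum.inr e.white),
        Finset.sum_sub_distrib, ← σ.sum_comp]
      rfl
    rw [← sub_self (∑ x, g (Sum.inl x) - ∑ y, g (Sum.inr y))]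
    conv_rhs => rw [← key σ₁ h₁]
    conv_rhs => arg 2; rw [key σ₁ h₁, ← key σ₀ h₀]
    rw [← Finset.sum_sub_distrib]
    refine Finset.sum_congr rfl fun e _ => ?_
    simp only [c]
    split_ifs <;> simp)
  -- Across an edge `f` changes by `c`, which is odd exactly when the edge lies in one of the two
  -- covers but not in both.
  have hreg : IsRegion R (matchingDarts σ₀ h₀) (matchingDarts σ₁ h₁)
      fun d => Odd (f (R.faceOf d)) := by
    refine ⟨hm₀, hm₁, fun d => by rw [R.faceOf_faceStep], fun d => ?_⟩
    have key : ∀ e : Edge G, (Odd (f (R.faceOf e.dart.symm)) ↔ Odd (f (R.faceOf e.dart))) ↔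
        (e.dart = matchingDarts σ₀ h₀ e.dart.fst ↔ e.dart = matchingDarts σ₁ h₁ e.dart.fst) := by
      intro e
      rw [dart_eq_matchingDarts_iff, dart_eq_matchingDarts_iff]
      have he := hf e
      rw [eq_sub_iff_add_eq] at he
      rw [← he]
      simp only [c]
      by_cases h0 : σ₀ e.black = e.white <;> by_cases h1 : σ₁ e.black = e.white <;>
        simp only [h0, h1, if_true, if_false, Int.odd_iff, iff_true, iff_false,
          not_true] <;> omega
    obtain ⟨e, rfl | rfl⟩ := exists_eq_dart_or_symm hG d
    · exact key e
    · rw [hm₀.eq_symm_iff, hm₁.eq_symm_iff, ← key, SimpleGraph.Dart.symm_symm]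
      exact iff_comm
  let : Fintype {d : G.Dart // Odd (f (R.faceOf d))} := Fintype.ofFinite _
  have hfaces : (-1 : ℤˣ) ^ Fintype.card {F // Odd (f F)} =
      (-1) ^ Fintype.card {d : {d : G.Dart // Odd (f (R.faceOf d))} // d.1.fst.isLeft} *
        Equiv.Perm.sign (σ₁.trans σ₀.symm) := by
    have hπ : ∀ x, (matchingDarts σ₀ h₀ (matchingDarts σ₁ h₁ (Sum.inl x)).snd).snd =
        Sum.inl (σ₁.trans σ₀.symm x) := fun x => rfl
    have hs := hreg.sign_alternate (π := σ₁.trans σ₀.symm) (hG := hG) hπ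
    have hp := hreg.neg_one_pow_card_faces (fun F => Odd (f F)) fun d => Iff.rfl
    exact hp.trans hs
  have h1 : ∏ e, ε e ^ c e = (∏ x, ε (edgeOf σ₁ h₁ x)) / ∏ x, ε (edgeOf σ₀ h₀ x) := by
    rw [← prod_edge_ite σ₁ h₁, ← prod_edge_ite σ₀ h₀, ← Finset.prod_div_distrib]
    refine Finset.prod_congr rfl fun e _ => ?_
    rw [zpow_sub₀ (hne e)]
    split_ifs <;> simp
  have h2 : ∏ e, ε e ^ c e = ∏ d, dartFactor ε d ^ f (R.faceOf d) := by
    rw [prod_dart hG]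
    refine Finset.prod_congr rfl fun e _ => ?_
    change _ = ε e ^ _ * (ε e)⁻¹ ^ _
    rw [hf e, zpow_sub₀ (hne e), inv_zpow, div_eq_mul_inv]
  -- Grouped by faces, each alternating product is replaced by minus the product of the colour
  -- signs.
  have h3 : ∏ d, dartFactor ε d ^ f (R.faceOf d) =
      (∏ F, (-1 : ℂ) ^ f F) * ∏ d, colourSign d ^ f (R.faceOf d) := by
    rw [prod_fiber_zpow, prod_fiber_zpow, ← Finset.prod_mul_distrib]
    refine Finset.prod_congr rfl fun F _ => ?_
    obtain ⟨d₀, rfl⟩ := R.faceOf_surjective F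
    have := hε.alternatingProduct_eq hG d₀
    have hfilter : Finset.univ.filter (fun d => R.faceOf d = R.faceOf d₀) = R.faceDarts d₀ := by
      ext d; rw [R.mem_faceDarts]; simp
    rw [hfilter, ← mul_zpow, neg_one_mul, ← this]
    rfl
  have h4 : ∏ d : G.Dart, (colourSign d : ℂ) ^ f (R.faceOf d) =
      (-1) ^ Fintype.card {d : {d : G.Dart // Odd (f (R.faceOf d))} // d.1.fst.isLeft} := by
    have : ∀ d : G.Dart, (colourSign d : ℂ) ^ f (R.faceOf d) =
        if Odd (f (R.faceOf d)) ∧ d.fst.isLeft then -1 else 1 := by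
      intro d
      by_cases hd : d.fst.isLeft <;> simp [colourSign, hd, neg_one_zpow_eq_ite]
    rw [Finset.prod_congr rfl fun d _ => this d, Fintype.card_congr
      (Equiv.subtypeSubtypeEquivSubtypeInter (fun d : G.Dart => Odd (f (R.faceOf d)))
        fun d => (d.fst.isLeft : Prop)), Fintype.card_subtype, Finset.prod_ite]
    simp
  -- The parity of the black darts of the region now occurs twice and cancels; only the sign of the
  -- permutation is left.
  have h5 := congrArg (fun u : ℤˣ => ((u : ℤ) : ℂ)) hfaces
  push_cast at h5
  rw [← h2, h1, prod_neg_one_zpow, h4, h5, mul_right_comm, ← mul_pow, neg_one_mul, neg_neg, one_pow,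
    one_mul, div_eq_iff (Finset.prod_ne_zero_iff.2 fun _ _ => hne _)] at h3
  rw [h3, ← mul_assoc, ← Int.cast_mul, ← Units.val_mul, Int.units_mul_self]
  simp

/-! ### Kasteleyn's theorem for the determinant -/

open Classical in
/-- The dimer cover that is given by a bijection. -/
noncomputable def coverOf [Fintype B] [Fintype W]
    (σ : {σ : B ≃ W // ∀ x, G.Adj (Sum.inl x) (Sum.inr (σ x))}) : DimerCover G :=
  ⟨Finset.univ.filter fun e => σ.1 e.black = e.white, by
    constructor
    · intro x
      refine ⟨edgeOf σ.1 σ.2 x, ⟨Finset.mem_filter.2 ⟨Finset.mem_univ _, rfl⟩, rfl⟩, ?_⟩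
      rintro e ⟨he, rfl⟩
      exact (edgeOf_eq_iff.2 (Finset.mem_filter.1 he).2).symm
    · intro y
      refine ⟨edgeOf σ.1 σ.2 (σ.1.symm y), ⟨Finset.mem_filter.2 ⟨Finset.mem_univ _, rfl⟩,
        σ.1.apply_symm_apply y⟩, ?_⟩
      rintro e ⟨he, rfl⟩
      have he' := (Finset.mem_filter.1 he).2
      rw [← he', Equiv.symm_apply_apply]
      exact (edgeOf_eq_iff.2 he').symm⟩

theorem mem_coverOf [Fintype B] [Fintype W]
    (σ : {σ : B ≃ W // ∀ x, G.Adj (Sum.inl x) (Sum.inr (σ x))}) (e : Edge G) :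
    e ∈ (coverOf σ).edges ↔ σ.1 e.black = e.white := by
  simp [coverOf, DimerCover.edges]

theorem coverOf_bijective [Fintype B] [Fintype W] :
    Function.Bijective (coverOf (G := G)) := by
  constructor
  · intro σ σ' h
    refine Subtype.ext (Equiv.ext fun x => ?_)
    have := (mem_coverOf σ (edgeOf σ.1 σ.2 x)).2 rfl
    rw [h, mem_coverOf] at this
    exact this.symm
  · rintro ⟨M, hB, hW⟩
    have hB' := hB
    have hW' := hW
    choose f hf hf' using hB'
    choose g hg hg' using hW'
    have hfg : ∀ x, g (f x).white = f x := fun x => (hg' _ _ ⟨(hf x).1, rfl⟩).symm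
    have hgf : ∀ y, f (g y).black = g y := fun y => (hf' _ _ ⟨(hg y).1, rfl⟩).symm
    let σ : B ≃ W :=
      { toFun := fun x => (f x).white
        invFun := fun y => (g y).black
        left_inv := fun x => (congrArg Edge.black (hfg x)).trans (hf x).2
        right_inv := fun y => (congrArg Edge.white (hgf y)).trans (hg y).2 }
    have hσ : ∀ x, G.Adj (Sum.inl x) (Sum.inr (σ x)) := by
      intro x
      have h := (f x).dart.adj
      rw [Edge.dart_fst, (hf x).2] at h
      exact h
    refine ⟨⟨σ, hσ⟩, Subtype.ext (Finset.ext fun e => ?_)⟩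
    refine (mem_coverOf ⟨σ, hσ⟩ e).trans ⟨fun h => ?_, fun h => ?_⟩
    · have : f e.black = e := Edge.ext_ends (hf _).2 h
      exact this ▸ (hf e.black).1
    · have : e = f e.black := hf' _ _ ⟨h, rfl⟩
      exact congrArg Edge.white this.symm

theorem prod_coverOf [Fintype B] [Fintype W] {A : Type*} [CommMonoid A]
    (σ : {σ : B ≃ W // ∀ x, G.Adj (Sum.inl x) (Sum.inr (σ x))}) (F : Edge G → A) :
    ∏ e ∈ (coverOf σ).edges, F e = ∏ x, F (edgeOf σ.1 σ.2 x) := by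
  classical
  rw [← prod_edge_ite σ.1 σ.2, ← Finset.prod_filter]
  refine Finset.prod_congr (Finset.ext fun e => ?_) fun _ _ => rfl
  rw [mem_coverOf]
  simp

open Classical in
/-- The Kasteleyn matrix for complex edge weights. -/
noncomputable def weightMatrix (ε x : Edge G → ℂ) : Matrix B W ℂ :=
  Matrix.of fun b w => if h : G.Adj (Sum.inl b) (Sum.inr w) then ε ⟨(b, w), h⟩ * x ⟨(b, w), h⟩ else 0

theorem weightMatrix_edge (ε x : Edge G → ℂ) (e : Edge G) :
    weightMatrix ε x e.black e.white = ε e * x e :=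
  dif_pos e.2

theorem weightMatrix_of_not_adj (ε x : Edge G → ℂ) {b : B} {w : W}
    (h : ¬ G.Adj (Sum.inl b) (Sum.inr w)) : weightMatrix ε x b w = 0 :=
  dif_neg h

/-- **Kasteleyn's theorem**, for arbitrary complex edge weights. -/
theorem IsKasteleynWeighting.det_weightMatrix [Fintype B] [Fintype W] [DecidableEq B]
    {R : RotationSystem G} {ε : Edge G → ℂ} (hε : IsKasteleynWeighting R ε) (hR : R.IsPlanar)
    (hG : G.IsBipartiteWith (Set.range Sum.inl) (Set.range Sum.inr)) (σ₀ : B ≃ W)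
    (h₀ : ∀ x, G.Adj (Sum.inl x) (Sum.inr (σ₀ x))) (x : Edge G → ℂ) :
    ((weightMatrix ε x).submatrix id σ₀).det =
      (∏ v, ε (edgeOf σ₀ h₀ v)) * ∑ M : DimerCover G, ∏ e ∈ M.edges, x e := by
  classical
  obtain ⟨F, hF⟩ : ∃ F : (B ≃ W) → ℂ, F = fun σ =>
    ((Equiv.Perm.sign (σ.trans σ₀.symm) : ℤ) : ℂ) * ∏ v, weightMatrix ε x v (σ v) := ⟨_, rfl⟩
  -- Composition with `σ₀` turns the permutations of `B` in the Leibniz formula into bijections from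
  -- `B` to `W`; those that use a non-edge contribute zero.
  have h1 : ((weightMatrix ε x).submatrix id σ₀).det = ∑ σ, F σ := by
    rw [← Matrix.det_transpose, Matrix.det_apply',
      ← (Equiv.equivCongr (Equiv.refl B) σ₀).sum_comp]
    refine Finset.sum_congr rfl fun π _ => ?_
    have : (Equiv.equivCongr (Equiv.refl B) σ₀ π).trans σ₀.symm = π := by ext; simp
    simp only [hF, this]
    simp
  have h2 : ∑ σ, F σ = ∑ σ : {σ : B ≃ W // ∀ x, G.Adj (Sum.inl x) (Sum.inr (σ x))}, F σ := by
    rw [← Finset.sum_subtype (Finset.univ.filter fun σ : B ≃ W =>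
      ∀ x, G.Adj (Sum.inl x) (Sum.inr (σ x))) (by simp) F]
    refine (Finset.sum_filter_of_ne fun σ _ hσ => ?_).symm
    by_contra hn
    push Not at hn
    obtain ⟨v, hv⟩ := hn
    rw [hF] at hσ
    exact hσ (mul_eq_zero_of_right _
      (Finset.prod_eq_zero (Finset.mem_univ v) (weightMatrix_of_not_adj _ _ hv)))
  have h3 : ∀ σ : {σ : B ≃ W // ∀ x, G.Adj (Sum.inl x) (Sum.inr (σ x))},
      F σ = (∏ v, ε (edgeOf σ₀ h₀ v)) * ∏ e ∈ (coverOf σ).edges, x e := by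
    intro σ
    have h4 : ∏ v, weightMatrix ε x v (σ.1 v) =
        (∏ v, ε (edgeOf σ.1 σ.2 v)) * ∏ v, x (edgeOf σ.1 σ.2 v) := by
      rw [← Finset.prod_mul_distrib]
      exact Finset.prod_congr rfl fun v _ => weightMatrix_edge ε x (edgeOf σ.1 σ.2 v)
    rw [prod_coverOf, ← hε.sign_mul_prod hR hG σ₀ σ.1 h₀ σ.2, mul_assoc, ← h4, hF]
  rw [h1, h2, Finset.mul_sum]
  exact Fintype.sum_bijective coverOf coverOf_bijective _ _ h3

theorem partitionFunction_pos [Fintype B] [Fintype W] [Nonempty (DimerCover G)] {ν : Edge G → ℝ}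
    (hν : ∀ e, 0 < ν e) : 0 < partitionFunction ν :=
  Finset.sum_pos (fun _ _ => Finset.prod_pos fun e _ => hν e) Finset.univ_nonempty

/-! ### Edge probabilities from perturbed determinants -/

open Classical in
/-- If a determinant with perturbed edge weights is the generating function of the number of
chosen edges, then its top coefficient is the weight of the covers that contain all of them. -/
theorem mul_det_eq_of_forall_det_one_add_smul {Ω : Type*} [Fintype Ω] {k : ℕ}
    (T : Matrix (Fin k) (Fin k) ℂ) (Z : ℂ) (wt : Ω → ℂ) (A : Fin k → Ω → Prop)
    (h : ∀ s : ℂ, Z * (1 + s • T).det = ∑ ω, wt ω * ∏ i, (1 + if A i ω then s else 0)) :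
    Z * T.det = ∑ ω ∈ Finset.univ.filter (fun ω => ∀ i, A i ω), wt ω := by
  -- With s = 1/q, multiplication by q^k turns the hypothesis into an identity of polynomials in q,
  -- valid for q ≠ 0 and by continuity at q = 0. There it reads off the coefficient of s^k.
  have key : (fun q : ℂ => Z * (q • (1 : Matrix (Fin k) (Fin k) ℂ) + T).det) =
      fun q => ∑ ω, wt ω * ∏ i, (q + if A i ω then 1 else 0) := by
    refine Continuous.ext_on (dense_compl_singleton (0 : ℂ)) ?_ ?_ ?_
    · fun_prop
    · fun_prop
    · intro q hq
      have hq : q ≠ 0 := hq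
      have h1 : q • (1 : Matrix (Fin k) (Fin k) ℂ) + T = q • (1 + q⁻¹ • T) := by
        rw [smul_add, smul_inv_smul₀ hq]
      simp only
      rw [h1, Matrix.det_smul, mul_left_comm, h, Finset.mul_sum]
      refine Finset.sum_congr rfl fun ω _ => ?_
      rw [mul_left_comm, ← Finset.card_univ, ← Finset.prod_const, ← Finset.prod_mul_distrib]
      congr 1
      refine Finset.prod_congr rfl fun i _ => ?_
      split_ifs
      · rw [mul_add, mul_inv_cancel₀ hq, mul_one]
      · simp
  have := congrFun key 0
  simp only [zero_smul, zero_add] at this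
  rw [this, Finset.sum_filter]
  refine Finset.sum_congr rfl fun ω _ => ?_
  rw [Finset.prod_boole]
  simp

theorem weightMatrix_ofReal (ε : Edge G → ℂ) (ν : Edge G → ℝ) :
    weightMatrix ε (fun e => (ν e : ℂ)) = kasteleynMatrix ν ε := rfl

/-- Perturbing the weights of some edges adds a product of two rectangular matrices to the
Kasteleyn matrix. -/
theorem weightMatrix_perturb [DecidableEq B] [DecidableEq W] (ε x : Edge G → ℂ) {k : ℕ}
    (p : Fin k → Edge G) [DecidablePred (· ∈ Set.range p)] (hp : Function.Injective p) (s : ℂ) :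
    weightMatrix ε (fun e => x e * (1 + if e ∈ Set.range p then s else 0)) =
      weightMatrix ε x +
        s • ((Matrix.of fun b i => if b = (p i).black then
            weightMatrix ε x (p i).black (p i).white else 0) *
          Matrix.of fun i w => if w = (p i).white then (1 : ℂ) else 0) := by
  ext b w
  rw [Matrix.add_apply, Matrix.smul_apply, Matrix.mul_apply]
  simp only [Matrix.of_apply, mul_ite, mul_one, mul_zero, smul_eq_mul]
  by_cases h : G.Adj (Sum.inl b) (Sum.inr w)
  · obtain ⟨e, rfl, rfl⟩ : ∃ e : Edge G, b = e.black ∧ w = e.white := ⟨⟨(b, w), h⟩, rfl, rfl⟩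
    have hterm : ∀ i, (if e.white = (p i).white then if e.black = (p i).black then
        weightMatrix ε x (p i).black (p i).white else 0 else 0) =
        if e = p i then ε e * x e else 0 := by
      intro i
      by_cases he : e = p i
      · subst he
        simp [weightMatrix_edge]
      · rw [if_neg he]
        split_ifs with h1 h2
        · exact absurd (Edge.ext_ends h2 h1) he
        · rfl
        · rfl
    rw [Finset.sum_congr rfl fun i _ => hterm i, weightMatrix_edge, weightMatrix_edge]
    by_cases he : e ∈ Set.range p
    · obtain ⟨j, rfl⟩ := he
      simp only [hp.eq_iff, Set.mem_range_self, if_true, Finset.sum_ite_eq, Finset.mem_univ]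
      ring
    · rw [if_neg he, Finset.sum_eq_zero]
      · ring
      · intro i _
        exact if_neg fun h => he ⟨i, h.symm⟩
  · rw [weightMatrix_of_not_adj _ _ h, weightMatrix_of_not_adj _ _ h, Finset.sum_eq_zero]
    · ring
    · intro i _
      split_ifs with h1 h2
      · exact absurd (h1 ▸ h2 ▸ (p i).2) h
      · rfl
      · rfl

theorem prod_one_add_range {E : Type*} {k : ℕ} (M : Finset E) [DecidablePred (· ∈ M)]
    (p : Fin k → E) [DecidablePred (· ∈ Set.range p)] (hp : Function.Injective p) (s : ℂ) :
    ∏ e ∈ M, (1 + if e ∈ Set.range p then s else 0) = ∏ i, (1 + if p i ∈ M then s else 0) := by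
  have hite : ∀ (P : Prop) [Decidable P], 1 + (if P then s else 0) = if P then 1 + s else 1 := by
    intro P _
    split_ifs <;> simp
  simp only [hite]
  rw [← Finset.prod_filter, ← Finset.prod_filter]
  refine (Finset.prod_bij (fun i _ => p i) ?_ ?_ ?_ ?_).symm
  · intro i hi
    exact Finset.mem_filter.2 ⟨(Finset.mem_filter.1 hi).2, i, rfl⟩
  · exact fun i _ j _ h => hp h
  · intro e he
    obtain ⟨h, i, rfl⟩ := Finset.mem_filter.1 he
    exact ⟨i, Finset.mem_filter.2 ⟨Finset.mem_univ _, h⟩, rfl⟩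
  · exact fun _ _ => rfl

/-- The identity det(1 + XY) = det(1 + YX) reduces a perturbation through k edges to a determinant
of size k. -/
theorem det_add_smul_mul {n : Type*} [Fintype n] [DecidableEq n] {k : ℕ} (A C : Matrix n n ℂ)
    (hAC : A * C = 1) (U : Matrix n (Fin k) ℂ) (V : Matrix (Fin k) n ℂ) (s : ℂ) :
    (A + s • (U * V)).det = A.det * (1 + s • (V * C * U)).det := by
  have h : A + s • (U * V) = A * (1 + C * (s • U) * V) := by
    rw [mul_add, mul_one, Matrix.mul_assoc, ← Matrix.mul_assoc A, hAC, Matrix.one_mul,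
      Matrix.smul_mul]
  rw [h, Matrix.det_mul, Matrix.det_one_add_mul_comm, Matrix.mul_smul, Matrix.mul_smul,
    Matrix.mul_assoc]

end Bipartite

end DimerModel

theorem mainTheorem2 {B W : Type*} [Fintype B] [Fintype W] [DecidableEq B] [DecidableEq W]
    (G : SimpleGraph (B ⊕ W))
    (hG : G.IsBipartiteWith (Set.range Sum.inl) (Set.range Sum.inr))
    (R : DimerModel.RotationSystem G) (hR : R.IsPlanar)
    (hM : Nonempty (DimerModel.DimerCover G))
    (ν : DimerModel.Edge G → ℝ) (hν : ∀ e, 0 < ν e)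
    (ε : DimerModel.Edge G → ℂ) (hε : DimerModel.IsKasteleynWeighting R ε)
    (K : Matrix B W ℂ) (hK : K = DimerModel.kasteleynMatrix ν ε) :
    ∃ Kinv : Matrix W B ℂ, K * Kinv = 1 ∧ Kinv * K = 1 ∧
      (∀ (k : ℕ) (p : Fin k → DimerModel.Edge G), Function.Injective p →
        ((DimerModel.prob (DimerModel.boltzmann ν)
            {M : DimerModel.DimerCover G | ∀ i, p i ∈ M.edges} : ℝ) : ℂ)
          = (∏ i, K (p i).black (p i).white)
            * (Matrix.of fun i j : Fin k => Kinv (p i).white (p j).black).det) ∧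
      DimerModel.IsDeterminantalProcess (DimerModel.boltzmann ν)
        (fun M : DimerModel.DimerCover G => M.edges)
        (fun e e' => K e.black e.white * Kinv e.white e'.black) := by
  classical
  -- The rows and columns of `K` have different index types; a fixed cover identifies them, so that
  -- the determinant makes sense.
  obtain ⟨⟨σ₀, h₀⟩, -⟩ := DimerModel.coverOf_bijective.2 hM.some
  have hZ : (DimerModel.partitionFunction ν : ℂ) ≠ 0 :=
    Complex.ofReal_ne_zero.2 (DimerModel.partitionFunction_pos hν).ne'
  have hε0 : ∏ v, ε (DimerModel.edgeOf σ₀ h₀ v) ≠ 0 := Finset.prod_ne_zero_iff.2 fun v _ h => by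
    simpa [h] using hε.norm_eq_one (DimerModel.edgeOf σ₀ h₀ v)
  rw [← DimerModel.weightMatrix_ofReal] at hK
  have hdet := fun x : DimerModel.Edge G → ℂ => hε.det_weightMatrix hR hG σ₀ h₀ x
  have hdetK : (K.submatrix id σ₀).det =
      (∏ v, ε (DimerModel.edgeOf σ₀ h₀ v)) * (DimerModel.partitionFunction ν : ℂ) := by
    rw [hK, hdet, DimerModel.partitionFunction]
    push_cast
    rfl
  have hunit : IsUnit (K.submatrix id σ₀).det := by
    rw [hdetK]; exact (mul_ne_zero hε0 hZ).isUnit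
  obtain ⟨C, hC⟩ : ∃ C, C = (K.submatrix id σ₀)⁻¹ := ⟨_, rfl⟩
  have hKC : K.submatrix id σ₀ * C = 1 := hC ▸ Matrix.mul_nonsing_inv _ hunit
  have hCK : C * K.submatrix id σ₀ = 1 := hC ▸ Matrix.nonsing_inv_mul _ hunit
  have hK' : (K.submatrix id σ₀).submatrix id σ₀.symm = K := by
    ext b w; simp
  have hstat : ∀ (k : ℕ) (p : Fin k → DimerModel.Edge G), Function.Injective p →
      ((DimerModel.prob (DimerModel.boltzmann ν)
          {M : DimerModel.DimerCover G | ∀ i, p i ∈ M.edges} : ℝ) : ℂ)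
        = (∏ i, K (p i).black (p i).white)
          * (Matrix.of fun i j : Fin k => C (σ₀.symm (p i).white) (p j).black).det := by
    intro k p hp
    -- This matrix is the product V C U of the rank-k perturbation; since U carries the weights of
    -- the chosen edges, they appear as column factors.
    have key := DimerModel.mul_det_eq_of_forall_det_one_add_smul
      (Matrix.of fun i j : Fin k => K (p j).black (p j).white *
        (Matrix.of fun i j : Fin k => C (σ₀.symm (p i).white) (p j).black) i j)
      (DimerModel.partitionFunction ν : ℂ)
      (fun M : DimerModel.DimerCover G => ∏ e ∈ M.edges, (ν e : ℂ)) (fun i M => p i ∈ M.edges) (by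
        intro s
        have h1 := hdet fun e => (ν e : ℂ) * (1 + if e ∈ Set.range p then s else 0)
        rw [DimerModel.weightMatrix_perturb _ _ _ hp, ← hK] at h1
        have h2 := DimerModel.det_add_smul_mul _ C hKC
          (Matrix.of fun b i => if b = (p i).black then K (p i).black (p i).white else 0)
          (Matrix.of fun (i : Fin k) (x : B) => if σ₀ x = (p i).white then (1 : ℂ) else 0) s
        have h3 : (Matrix.of fun (i : Fin k) (x : B) => if σ₀ x = (p i).white then (1 : ℂ) else 0) * C
            * (Matrix.of fun b i => if b = (p i).black then K (p i).black (p i).white else 0) =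
            Matrix.of fun i j : Fin k => K (p j).black (p j).white *
              (Matrix.of fun i j : Fin k => C (σ₀.symm (p i).white) (p j).black) i j := by
          ext i j
          simp [Matrix.mul_apply, ← Equiv.eq_symm_apply, mul_comm]
        rw [h3, hdetK] at h2
        have h4 := h2.symm.trans h1
        rw [mul_assoc, mul_right_inj' hε0] at h4
        rw [h4]
        refine Finset.sum_congr rfl fun M _ => ?_
        rw [Finset.prod_mul_distrib]
        congr 1
        convert DimerModel.prod_one_add_range M.edges p hp s)
    rw [Matrix.det_mul_row] at key
    rw [← inv_mul_cancel_left₀ hZ (_ * _), key, DimerModel.prob, Finset.mul_sum]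
    push_cast [DimerModel.boltzmann]
    congr!
  refine ⟨C.submatrix σ₀.symm id, ?_, ?_, hstat, ?_⟩
  · rw [← hK', Matrix.submatrix_mul_equiv, hKC, Matrix.submatrix_id_id]
  · conv_lhs => rw [← hK']
    rw [← Matrix.submatrix_mul _ _ _ id _ Function.bijective_id, hCK, Matrix.submatrix_one_equiv]
  · intro k p hp
    -- The kernel carries the factor of K in its rows rather than its columns, with the same
    -- determinant.
    refine (hstat k p hp).trans (Matrix.det_mul_column _ _).symm
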